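/- **Conventions.** A germ $(X,x)\subset(\mathbb C^n,x)$ of a complex analytic space is given by a proper ideal $\mathcal I_{X,x}$ of the ring $\mathcal O_{\mathbb C^n,x}\cong\mathbb C\{x_1,\dots,x_n\}$ of convergent power series; its local ring is $\mathcal O_{X,x}=\mathcal O_{\mathbb C^n,x}/\mathcal I_{X,x}$. A morphism of germs $(Y,y)\to(X,x)$ is given by the induced homomorphism of $\mathbb C$-algebras $\mathcal O_{X,x}\to\mathcal O_{Y,y}$; it exhibits $(Y,y)$ as a subspace of $(X,x)$ if this homomorphism is surjective. For an $\mathcal O_{X,x}$-module $M$ put $\beta_i^{(X,x)}(M)=\dim_{\mathbb C}\operatorname{Tor}_i^{\mathcal O_{X,x}}(M,\mathbb C)$, where $\mathbb C$ is the residue field, and $P^{(X,x)}_M(t)=\sum_{i\ge0}\beta_i^{(X,x)}(M)t^i$. For a morphism $(Y,y)\to(X,x)$ put $\beta_i^{(X,x)}(Y,y)=\beta_i^{(X,x)}(\mathcal O_{Y,y})$ and $P^{(X,x)}_{(Y,y)}=P^{(X,x)}_{\mathcal O_{Y,y}}$. A morphism $(Y,y)\to(X,x)$ is *large* if $P^{(X,x)}_{(T,t)}=P^{(Y,y)}_{(T,t)}\,P^{(X,x)}_{(Y,y)}$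 for every reduced subspace $(T,t)$ of $(Y,y)$. **Statement.** Let $(X,x)$, $(Y,y)$, $(Z,z)$ be germs of complex analytic spaces, let $\alpha:(Z,z)\to(X,x)$ and $\beta:(Z,z)\to(Y,y)$ be morphisms such that $\alpha^*:\mathcal O_{X,x}\to\mathcal O_{Z,z}$ and $\beta^*:\mathcal O_{Y,y}\to\mathcal O_{Z,z}$ are surjective, and let $(\mathcal V,v)=(X,x)\sqcup_{(Z,z)}(Y,y)$ be their gluing, i.e. the push-out of $\alpha$ and $\beta$ in the category of germs of analytic spaces, with structure maps $f:(X,x)\to(\mathcal V,v)$ and $g:(Y,y)\to(\mathcal V,v)$. Assume that one of the following conditions holds: * (a) $(\mathcal V,v)$ is weakly large, i.e. $P^{(\mathcal V,v)}_{K}=P^{(X,x)}_{K}\,P^{(\mathcal V,v)}_{(X,x)}$ for the $\mathcal O_{X,x}$-module $K=\ker\alpha^*$ (an $\mathcal O_{\mathcal V,v}$-module through $f$), and there is a surjective homomorphism of $\mathbb C$-algebras $\gamma^*:\mathcal O_{Y,y}\to\mathcal O_{X,x}$ with $\alpha^*\circ\gamma^*=\beta^*$; * (b) $(\mathcal V,v)$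 is strongly large, i.e. both $f$ and $g$ are large. Let $(W,w)$ be a subspace of $(Y,y)$, regarded also as a subspace of $(\mathcal V,v)$ through $g$. Then * (i) $\beta_0^{(\mathcal V,v)}(W,w)=\beta_0^{(Y,y)}(W,w)$; * (ii) $\beta_1^{(\mathcal V,v)}(W,w)=\beta_0^{(Y,y)}(W,w)\,\beta_1^{(X,x)}(Z,z)+\beta_1^{(Y,y)}(W,w)$; * (iii) $\beta_2^{(\mathcal V,v)}(W,w)=\beta_0^{(Y,y)}(W,w)\,\beta_1^{(Y,y)}(Z,z)\,\beta_1^{(X,x)}(Z,z)+\beta_0^{(Y,y)}(W,w)\,\beta_2^{(X,x)}(Z,z)+\beta_1^{(Y,y)}(W,w)\,\beta_1^{(X,x)}(Z,z)+\beta_2^{(Y,y)}(W,w)$. -/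

import Mathlib

open CategoryTheory

/-- A formal power series over `ℂ` in finitely many variables is convergent if it converges
absolutely on some polydisc of positive radius around the origin. -/
def IsConvergentSeries {n : ℕ} (f : MvPowerSeries (Fin n) ℂ) : Prop :=
  ∃ r : ℝ, 0 < r ∧ Summable fun a : Fin n →₀ ℕ => ‖MvPowerSeries.coeff a f‖ * r ^ a.degree

theorem IsConvergentSeries.summable_of_le {n : ℕ} {f : MvPowerSeries (Fin n) ℂ} {r s : ℝ}
    (hr : 0 ≤ r) (hrs : r ≤ s)
    (h : Summable fun a : Fin n →₀ ℕ => ‖MvPowerSeries.coeff a f‖ * s ^ a.degree) :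
    Summable fun a : Fin n →₀ ℕ => ‖MvPowerSeries.coeff a f‖ * r ^ a.degree :=
  Summable.of_nonneg_of_le (fun a => by positivity) (fun a => by gcongr) h

theorem isConvergentSeries_C {n : ℕ} (c : ℂ) :
    IsConvergentSeries (MvPowerSeries.C c : MvPowerSeries (Fin n) ℂ) := by
  classical
  refine ⟨1, one_pos, summable_of_ne_finset_zero (s := {0}) fun a ha => ?_⟩
  simp only [Finset.mem_singleton] at ha
  simp [MvPowerSeries.coeff_C, ha]

theorem IsConvergentSeries.add {n : ℕ} {f g : MvPowerSeries (Fin n) ℂ}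
    (hf : IsConvergentSeries f) (hg : IsConvergentSeries g) : IsConvergentSeries (f + g) := by
  obtain ⟨r, hr, h1⟩ := hf
  obtain ⟨s, hs, h2⟩ := hg
  have hm : 0 < min r s := lt_min hr hs
  refine ⟨min r s, hm, Summable.of_nonneg_of_le (fun a => by positivity) (fun a => ?_)
    ((summable_of_le hm.le (min_le_left r s) h1).add
      (summable_of_le hm.le (min_le_right r s) h2))⟩
  rw [map_add, ← add_mul]
  gcongr
  exact norm_add_le _ _

theorem IsConvergentSeries.mul {n : ℕ} {f g : MvPowerSeries (Fin n) ℂ}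
    (hf : IsConvergentSeries f) (hg : IsConvergentSeries g) : IsConvergentSeries (f * g) := by
  classical
  obtain ⟨r, hr, h1⟩ := hf
  obtain ⟨s, hs, h2⟩ := hg
  have hm : 0 < min r s := lt_min hr hs
  have h1' := summable_of_le hm.le (min_le_left r s) h1
  have h2' := summable_of_le hm.le (min_le_right r s) h2
  set A : (Fin n →₀ ℕ) → ℝ := fun a => ‖MvPowerSeries.coeff a f‖ * min r s ^ a.degree with hA
  set B : (Fin n →₀ ℕ) → ℝ := fun a => ‖MvPowerSeries.coeff a g‖ * min r s ^ a.degree with hB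
  have hA0 : 0 ≤ A := fun a => mul_nonneg (norm_nonneg _) (pow_nonneg hm.le _)
  have hB0 : 0 ≤ B := fun a => mul_nonneg (norm_nonneg _) (pow_nonneg hm.le _)
  have hAB := summable_sum_mul_antidiagonal_of_summable_mul (h1'.mul_of_nonneg h2' hA0 hB0)
  refine ⟨min r s, hm, Summable.of_nonneg_of_le
    (fun a => mul_nonneg (norm_nonneg _) (pow_nonneg hm.le _)) (fun a => ?_) hAB⟩
  rw [MvPowerSeries.coeff_mul]
  refine (mul_le_mul_of_nonneg_right (norm_sum_le _ _) (by positivity)).trans ?_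
  rw [Finset.sum_mul]
  refine Finset.sum_le_sum fun p hp => le_of_eq ?_
  rw [← Finset.HasAntidiagonal.mem_antidiagonal.mp hp, map_add, pow_add, norm_mul, hA, hB]
  ring

/-- The inverse of a convergent power series with non-zero constant term is convergent. -/
theorem IsConvergentSeries.inv {n : ℕ} {f : MvPowerSeries (Fin n) ℂ}
    (hf : IsConvergentSeries f) (hc : MvPowerSeries.constantCoeff f ≠ 0) :
    IsConvergentSeries f⁻¹ := by
  classical
  obtain ⟨s, hs, h⟩ := hf
  set A : (Fin n →₀ ℕ) → ℝ := fun a => if a = 0 then 0 else ‖MvPowerSeries.coeff a f‖ with hA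
  have hA0 : ∀ a, 0 ≤ A a := fun a => by simp only [hA]; split_ifs <;> positivity
  have hAs : Summable fun a => A a * s ^ a.degree := by
    refine Summable.of_nonneg_of_le (fun a => mul_nonneg (hA0 a) (by positivity))
      (fun a => ?_) h
    gcongr
    simp only [hA]
    split_ifs
    · positivity
    · exact le_rfl
  set M : ℝ := ∑' a, A a * s ^ a.degree with hM
  have hM0 : 0 ≤ M := tsum_nonneg fun a => mul_nonneg (hA0 a) (by positivity)
  set c : ℝ := ‖MvPowerSeries.constantCoeff f‖ with hcdef
  have hcpos : 0 < c := norm_pos_iff.mpr hc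
  set q : ℝ := min 1 (c / (2 * (M + 1))) with hq
  have hq0 : 0 < q := lt_min one_pos (by positivity)
  have hq1 : q ≤ 1 := min_le_left _ _
  have hqM : q * M ≤ c / 2 := by
    have h1 : q ≤ c / (2 * (M + 1)) := min_le_right _ _
    calc q * M ≤ c / (2 * (M + 1)) * (M + 1) :=
          mul_le_mul h1 (le_add_of_nonneg_right zero_le_one) hM0 (by positivity)
      _ = c / 2 := by field_simp
  have hbound : ∀ t : Finset (Fin n →₀ ℕ), ∑ a ∈ t, A a * (q * s) ^ a.degree ≤ c / 2 := by
    intro t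
    refine le_trans ?_ hqM
    calc ∑ a ∈ t, A a * (q * s) ^ a.degree ≤ ∑ a ∈ t, q * (A a * s ^ a.degree) := by
          refine Finset.sum_le_sum fun a _ => ?_
          by_cases ha : a = 0
          · simp [hA, ha]
          · have hd : a.degree ≠ 0 := fun h0 => ha ((Finsupp.degree_eq_zero_iff a).mp h0)
            have : q ^ a.degree ≤ q := pow_le_of_le_one hq0.le hq1 hd
            rw [mul_pow]
            calc A a * (q ^ a.degree * s ^ a.degree) ≤ A a * (q * s ^ a.degree) := by
                  gcongr
              _ = _ := by ring
      _ = q * ∑ a ∈ t, A a * s ^ a.degree := by rw [Finset.mul_sum]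
      _ ≤ q * M := by
          gcongr
          exact hAs.sum_le_tsum t fun a _ => mul_nonneg (hA0 a) (by positivity)
  set ρ : ℝ := q * s with hρ
  have hρ0 : 0 < ρ := mul_pos hq0 hs
  set B : (Fin n →₀ ℕ) → ℝ := fun a => ‖MvPowerSeries.coeff a f⁻¹‖ with hB
  have hrec : ∀ a, c * (B a * ρ ^ a.degree) ≤ (if a = 0 then 1 else 0) +
      ∑ p ∈ Finset.HasAntidiagonal.antidiagonal a, (A p.1 * ρ ^ p.1.degree) * (B p.2 * ρ ^ p.2.degree) := by
    intro a
    have h1 := congrArg (MvPowerSeries.coeff a) (MvPowerSeries.mul_inv_cancel f hc)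
    rw [MvPowerSeries.coeff_mul, MvPowerSeries.coeff_one,
      ← Finset.add_sum_erase (Finset.HasAntidiagonal.antidiagonal a) _ (a := ((0 : Fin n →₀ ℕ), a)) (by simp)] at h1
    have h2 : c * B a ≤ (if a = 0 then 1 else 0) +
        ∑ p ∈ Finset.HasAntidiagonal.antidiagonal a, A p.1 * B p.2 := by
      have h3 : MvPowerSeries.constantCoeff f * MvPowerSeries.coeff a f⁻¹ =
          (if a = 0 then 1 else 0) - ∑ p ∈ (Finset.HasAntidiagonal.antidiagonal a).erase (0, a),
            MvPowerSeries.coeff p.1 f * MvPowerSeries.coeff p.2 f⁻¹ := by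
        rw [← h1]; simp
      calc c * B a = ‖MvPowerSeries.constantCoeff f * MvPowerSeries.coeff a f⁻¹‖ := by
            rw [norm_mul]
        _ ≤ ‖(if a = 0 then 1 else 0 : ℂ)‖ + ‖∑ p ∈ (Finset.HasAntidiagonal.antidiagonal a).erase (0, a),
            MvPowerSeries.coeff p.1 f * MvPowerSeries.coeff p.2 f⁻¹‖ := by
            rw [h3]; exact norm_sub_le _ _
        _ ≤ (if a = 0 then 1 else 0) + ∑ p ∈ (Finset.HasAntidiagonal.antidiagonal a).erase (0, a),
            A p.1 * B p.2 := by
            gcongr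
            · split_ifs <;> simp
            · refine (norm_sum_le _ _).trans (Finset.sum_le_sum fun p hp => ?_)
              have hp1 : p.1 ≠ 0 := by
                intro h0
                rw [Finset.mem_erase, Finset.HasAntidiagonal.mem_antidiagonal] at hp
                apply hp.1
                ext1
                · exact h0
                · simpa [h0] using hp.2
              simp [hA, hB, hp1]
        _ ≤ _ := by
            refine add_le_add_right (Finset.sum_le_sum_of_subset_of_nonneg
              (Finset.erase_subset _ _) ?_) _
            exact fun p _ _ => mul_nonneg (hA0 _) (norm_nonneg _)
    calc c * (B a * ρ ^ a.degree) = (c * B a) * ρ ^ a.degree := by ring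
      _ ≤ ((if a = 0 then 1 else 0) + ∑ p ∈ Finset.HasAntidiagonal.antidiagonal a, A p.1 * B p.2) *
          ρ ^ a.degree := by gcongr
      _ = _ := by
          rw [add_mul, Finset.sum_mul]
          congr 1
          · split_ifs with h0 <;> simp [h0]
          · refine Finset.sum_congr rfl fun p hp => ?_
            rw [← Finset.HasAntidiagonal.mem_antidiagonal.mp hp, map_add, pow_add]
            ring
  have hBn : ∀ a, 0 ≤ B a * ρ ^ a.degree := fun a => by positivity
  have hAn : ∀ a, 0 ≤ A a * ρ ^ a.degree := fun a => mul_nonneg (hA0 a) (by positivity)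
  refine ⟨ρ, hρ0, summable_of_sum_le (c := 2 / c) hBn fun u => ?_⟩
  set t : Finset (Fin n →₀ ℕ) := u.biUnion fun a => Finset.Iic a with ht
  have hut : u ⊆ t := fun a ha => Finset.mem_biUnion.mpr ⟨a, ha, by simp⟩
  have hlow : ∀ a ∈ t, ∀ b ≤ a, b ∈ t := by
    intro a ha b hb
    obtain ⟨d, hd, had⟩ := Finset.mem_biUnion.mp ha
    exact Finset.mem_biUnion.mpr ⟨d, hd, Finset.mem_Iic.mpr (hb.trans (Finset.mem_Iic.mp had))⟩
  set T : ℝ := ∑ a ∈ t, B a * ρ ^ a.degree with hT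
  have hT0 : 0 ≤ T := Finset.sum_nonneg fun a _ => hBn a
  have hmain : c * T ≤ 1 + c / 2 * T := by
    calc c * T ≤ ∑ a ∈ t, ((if a = 0 then 1 else 0) + ∑ p ∈ Finset.HasAntidiagonal.antidiagonal a,
          (A p.1 * ρ ^ p.1.degree) * (B p.2 * ρ ^ p.2.degree)) := by
          rw [hT, Finset.mul_sum]
          exact Finset.sum_le_sum fun a _ => hrec a
      _ ≤ 1 + ∑ p ∈ t ×ˢ t, (A p.1 * ρ ^ p.1.degree) * (B p.2 * ρ ^ p.2.degree) := by
          rw [Finset.sum_add_distrib]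
          gcongr
          · rw [Finset.sum_ite_eq']
            split_ifs <;> simp
          · rw [← Finset.sum_biUnion]
            · refine Finset.sum_le_sum_of_subset_of_nonneg ?_
                fun p _ _ => mul_nonneg (hAn _) (hBn _)
              intro p hp
              obtain ⟨a, ha, hpa⟩ := Finset.mem_biUnion.mp hp
              rw [Finset.HasAntidiagonal.mem_antidiagonal] at hpa
              rw [Finset.mem_product]
              exact ⟨hlow a ha _ (hpa ▸ le_self_add), hlow a ha _ (hpa ▸ le_add_self)⟩
            · intro a _ b _ hab
              refine Finset.disjoint_left.mpr fun p h1 h2 => hab ?_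
              rw [Finset.HasAntidiagonal.mem_antidiagonal] at h1 h2
              exact h1.symm.trans h2
      _ = 1 + (∑ a ∈ t, A a * ρ ^ a.degree) * T := by
          rw [Finset.sum_product, hT, Finset.sum_mul_sum]
      _ ≤ 1 + c / 2 * T := by
          gcongr
          exact hbound t
  calc ∑ a ∈ u, B a * ρ ^ a.degree ≤ T :=
        Finset.sum_le_sum_of_subset_of_nonneg hut fun a _ _ => hBn a
    _ ≤ 2 / c := by
        rw [le_div_iff₀ hcpos]
        linarith

/-- The ring `ℂ{x₁, …, xₙ}` of convergent power series: the local ring of germs of holomorphic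
functions on `ℂⁿ` at a point, in the coordinates centred at that point. -/
def ConvergentSeries (n : ℕ) : Subalgebra ℂ (MvPowerSeries (Fin n) ℂ) where
  carrier := {f | IsConvergentSeries f}
  mul_mem' := IsConvergentSeries.mul
  add_mem' := IsConvergentSeries.add
  algebraMap_mem' := isConvergentSeries_C

instance (n : ℕ) : IsLocalRing (ConvergentSeries n) := by
  have hu : ∀ f : ConvergentSeries n, MvPowerSeries.constantCoeff f.1 ≠ 0 → IsUnit f := by
    intro f hf
    refine IsUnit.of_mul_eq_one ⟨f.1⁻¹, IsConvergentSeries.inv f.2 hf⟩ (Subtype.ext ?_)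
    exact MvPowerSeries.mul_inv_cancel f.1 hf
  refine IsLocalRing.of_isUnit_or_isUnit_one_sub_self fun a => ?_
  by_cases ha : MvPowerSeries.constantCoeff a.1 = 0
  · refine Or.inr (hu _ ?_)
    simp [ha]
  · exact Or.inl (hu a ha)

/-- A germ `(X, x) ⊂ (ℂⁿ, x)` of a complex analytic space, given by a proper ideal of the ring of
germs of holomorphic functions on `ℂⁿ` at `x`. -/
structure AnalyticGerm where
  /-- The dimension of the ambient space. -/
  n : ℕ
  /-- The ideal that defines the germ. -/
  ideal : Ideal (ConvergentSeries n)
  ideal_ne_top : ideal ≠ ⊤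

namespace AnalyticGerm

/-- The local ring `𝒪_{X,x}` of a germ. -/
def O (X : AnalyticGerm) : Type := ConvergentSeries X.n ⧸ X.ideal

noncomputable instance (X : AnalyticGerm) : CommRing X.O :=
  inferInstanceAs (CommRing (ConvergentSeries X.n ⧸ X.ideal))

noncomputable instance (X : AnalyticGerm) : Algebra ℂ X.O :=
  inferInstanceAs (Algebra ℂ (ConvergentSeries X.n ⧸ X.ideal))

instance (X : AnalyticGerm) : IsLocalRing X.O :=
  have : Nontrivial (ConvergentSeries X.n ⧸ X.ideal) :=
    Ideal.Quotient.nontrivial_iff.mpr X.ideal_ne_top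
  show IsLocalRing (ConvergentSeries X.n ⧸ X.ideal) from
    IsLocalRing.of_surjective' (Ideal.Quotient.mk X.ideal) Ideal.Quotient.mk_surjective

/-- The category of germs of analytic spaces. A morphism of germs `X ⟶ Y` is given by the
homomorphism of `ℂ`-algebras `𝒪_Y → 𝒪_X` which it induces (such a homomorphism is automatically
local, and is the pull-back of functions along a unique holomorphic map germ). -/
noncomputable instance : Category AnalyticGerm where
  Hom X Y := Y.O →ₐ[ℂ] X.O
  id X := AlgHom.id ℂ X.O
  comp f g := AlgHom.comp f g

/-- The pull-back of functions `𝒪_Y → 𝒪_X` along a morphism of germs `X ⟶ Y`. -/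
noncomputable def pullback {X Y : AnalyticGerm} (f : X ⟶ Y) : Y.O →ₐ[ℂ] X.O := f

/-- A morphism of germs that exhibits its source as a subspace of its target. -/
def IsClosedEmbedding {X Y : AnalyticGerm} (f : X ⟶ Y) : Prop :=
  Function.Surjective (pullback f)

/-- The Betti number `β_i(M) = dim_ℂ Tor_i(M, ℂ)` of a module over the local ring of a germ, where
`ℂ` is the residue field and `Tor_i(M, ℂ)` is a complex vector space through `ℂ → 𝒪_X`. -/
noncomputable def moduleBetti (X : AnalyticGerm) (M : ModuleCat.{0} X.O) (i : ℕ) : ℕ :=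
  letI T : ModuleCat.{0} X.O :=
    ((Tor (ModuleCat.{0} X.O) i).obj M).obj (ModuleCat.of X.O (IsLocalRing.ResidueField X.O))
  letI : Module ℂ T := Module.restrictScalars ℂ X.O T
  Module.finrank ℂ T

/-- The Poincaré series of a module over the local ring of a germ. -/
noncomputable def modulePoincare (X : AnalyticGerm) (M : ModuleCat.{0} X.O) : PowerSeries ℕ :=
  PowerSeries.mk fun i => moduleBetti X M i

/-- An `𝒪_Y`-module as an `𝒪_X`-module, along a morphism of germs `f : Y ⟶ X`. -/
noncomputable def restrict {X Y : AnalyticGerm} (f : Y ⟶ X) (M : ModuleCat.{0} Y.O) :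
    ModuleCat.{0} X.O :=
  (ModuleCat.restrictScalars (pullback f).toRingHom).obj M

/-- The `i`-th Betti number `β_i^X(Z)` of the germ `Z` over `X`, along `h : Z ⟶ X`. -/
noncomputable def betti {X Z : AnalyticGerm} (h : Z ⟶ X) (i : ℕ) : ℕ :=
  moduleBetti X (restrict h (ModuleCat.of Z.O Z.O)) i

/-- The Poincaré series `P_Z^X(t)` of the germ `Z` over `X`, along `h : Z ⟶ X`. -/
noncomputable def poincare {X Z : AnalyticGerm} (h : Z ⟶ X) : PowerSeries ℕ :=
  modulePoincare X (restrict h (ModuleCat.of Z.O Z.O))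

/-- A morphism `f : Y ⟶ X` is large if `P_Z^X = P_Z^Y P_Y^X` for every reduced subspace `Z` of
`Y`. -/
def IsLarge {X Y : AnalyticGerm} (f : Y ⟶ X) : Prop :=
  ∀ (Z : AnalyticGerm) (j : Z ⟶ Y), IsReduced Z.O → IsClosedEmbedding j →
    poincare (j ≫ f) = poincare j * poincare f

/-- The kernel of `𝒪_X → 𝒪_Z`, as an `𝒪_X`-module. -/
noncomputable def kernelModule {X Z : AnalyticGerm} (α : Z ⟶ X) : ModuleCat.{0} X.O :=
  ModuleCat.of X.O (RingHom.ker (pullback α))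

/-- The gluing of `X` and `Y` along `α : Z ⟶ X` and `β : Z ⟶ Y` is the push-out `V` of `α` and `β`
in the category of germs of analytic spaces; its structure maps are `f : X ⟶ V` and `g : Y ⟶ V`. -/
abbrev IsGluing {X Y Z V : AnalyticGerm} (α : Z ⟶ X) (β : Z ⟶ Y) (f : X ⟶ V) (g : Y ⟶ V) : Prop :=
  IsPushout α β f g

/-- The gluing with structure map `f : X ⟶ V` is weakly large if `P_K^V = P_K^X P_X^V`, where `K`
is the kernel of `𝒪_X → 𝒪_Z`. -/
def IsWeaklyLarge {X Z V : AnalyticGerm} (α : Z ⟶ X) (f : X ⟶ V) : Prop :=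
  modulePoincare V (restrict f (kernelModule α)) =
    modulePoincare X (kernelModule α) * poincare f

/-- The gluing with structure maps `f : X ⟶ V` and `g : Y ⟶ V` is strongly large if both structure
maps are large. -/
def IsStronglyLarge {X Y V : AnalyticGerm} (f : X ⟶ V) (g : Y ⟶ V) : Prop :=
  IsLarge f ∧ IsLarge g

end AnalyticGerm

/-!
# Betti numbers of subspaces of a gluing

Write `R`, `A`, `B`, `C` for the local rings of the gluing `V`, of `X`, of `Y` and of `Z`, and `k`
for the residue field `ℂ`.

*The gluing is a fibre product.* The functions on a germ that vanish at the base point are its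
morphisms to the germ of the line, since convergent series may be substituted in one another
(`AnalyticGerm.exists_hom_line`) and since the local rings, being noetherian, are separated for
the topology of the maximal ideal (`AnalyticGerm.hom_line_ext`). Testing the universal property of
the push-out on the line gives `R = A ×_C B` (`AnalyticGerm.eq_zero_of_isGluing`,
`AnalyticGerm.exists_of_isGluing`). Hence `R → A` and `R → B` are surjective, with kernels
`ker (B → C)` and `ker (A → C)`. That `ℂ{x₁, …, xₙ}` is noetherian follows from Grauert's division
theorem (`ConvergentSeries.exists_division`) and Dickson's lemma: an ideal is generated by
finitely many series whose leading exponents generate the set of all leading exponents.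

*Factorization of Poincaré series.* Let `R → S` be a surjection of local rings. If
`P^R_k = P^S_k P^R_S` up to degree `d`, then `P^R_M = P^S_M P^R_S` up to degree `d` for all finite
`S`-modules `M` (`LocalTor.bet_eq_sum`). The hypothesis makes `Tor^R_j(S, k) → Tor^R_j(k, k)`
injective for `j ≤ d`; therefore the map induced on `Tor^R_j` by the inclusion of a syzygy
`N ⊆ 𝔪 Sⁿ` of `M` vanishes, and the long exact sequence of `0 → N → Sⁿ → M → 0` splits into short
ones. This is applied to `S = B`. If `g` is large, the hypothesis holds because the reduced point
is a reduced subspace of `Y`. If `γ` is given, then `B` is a retract of `R`, and the hypothesis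
holds up to degree two (`LocalTor.bet_residueField_of_retract`).

*The Betti numbers of `B` over `R`.* With `K = ker (A → C) ≅ ker (R → B)`, the numbers
`β_{i+1}^R(B) = β_i^R(K)` are computed for `i ≤ 1` by `P^R_K = P^A_K P^R_A`, which is weak
largeness, or follows from largeness of `f` by the factorization above. This gives
`β_1^R(B) = β_1^A(C)` and `β_2^R(B) = β_2^A(C) + β_1^A(C) β_1^B(C)`, and the formulas are the
coefficients of `P^B_M P^R_B` (`LocalTor.bet_fibreProduct`).

Betti numbers are treated as lengths of `Tor` modules with values in `ℕ∞`, which are additive in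
exact sequences without finiteness conditions; they agree with the complex dimensions by
`LocalTor.length_complex_eq`.
-/

/-! ### Tor with the residue field -/

namespace LocalTor

universe u

variable (R : Type u) [CommRing R] [IsLocalRing R]

/-- `Tor_i^R(M, k)`, where `k` is the residue field of `R`. -/
noncomputable abbrev tor (i : ℕ) (M : Type u) [AddCommGroup M] [Module R M] : ModuleCat.{u} R :=
  ((Tor (ModuleCat.{u} R) i).obj (ModuleCat.of R M)).obj
    (ModuleCat.of R (IsLocalRing.ResidueField R))

variable {R} {M N P : Type u} [AddCommGroup M] [Module R M] [AddCommGroup N] [Module R N]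
  [AddCommGroup P] [Module R P]

/-- The map `Tor_i^R(M, k) → Tor_i^R(N, k)` induced by a linear map `M → N`. -/
noncomputable def torMap (i : ℕ) (f : M →ₗ[R] N) : tor R i M →ₗ[R] tor R i N :=
  (((Tor (ModuleCat.{u} R) i).map (ModuleCat.ofHom f)).app _).hom

lemma torMap_id (i : ℕ) : torMap i (LinearMap.id : M →ₗ[R] M) = LinearMap.id := by
  unfold torMap
  have h : ModuleCat.ofHom (LinearMap.id : M →ₗ[R] M) = 𝟙 _ := rfl
  rw [h, CategoryTheory.Functor.map_id]
  rfl

lemma torMap_comp (i : ℕ) (g : N →ₗ[R] P) (f : M →ₗ[R] N) :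
    torMap i (g ∘ₗ f) = torMap i g ∘ₗ torMap i f := by
  unfold torMap
  rw [ModuleCat.ofHom_comp, CategoryTheory.Functor.map_comp]
  rfl

/-- The complex `M ⊗ P` that computes `Tor_i^R(M, k)`, for the chosen projective resolution `P` of
the residue field `k`. -/
noncomputable abbrev torComplex (M : ModuleCat.{u} R) : ChainComplex (ModuleCat.{u} R) ℕ :=
  (((MonoidalCategory.tensoringLeft (ModuleCat.{u} R)).obj M).mapHomologicalComplex _).obj
    (projectiveResolution (ModuleCat.of R (IsLocalRing.ResidueField R))).complex

/-- The map of complexes `M ⊗ P → N ⊗ P` induced by `M → N`. -/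
noncomputable abbrev torComplexMap {M N : ModuleCat.{u} R} (f : M ⟶ N) :
    torComplex M ⟶ torComplex N :=
  (NatTrans.mapHomologicalComplex
    ((MonoidalCategory.tensoringLeft (ModuleCat.{u} R)).map f) _).app _

/-- `Tor_i^R(M, k)` as the homology of `M ⊗ P`. -/
noncomputable def torIso (i : ℕ) (M : Type u) [AddCommGroup M] [Module R M] :
    tor R i M ≅ (torComplex (ModuleCat.of R M)).homology i :=
  (projectiveResolution (ModuleCat.of R (IsLocalRing.ResidueField R))).isoLeftDerivedObj _ i

lemma torMap_eq (i : ℕ) (f : M →ₗ[R] N) :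
    ModuleCat.ofHom (torMap i f) = (torIso i M).hom ≫
      HomologicalComplex.homologyMap (torComplexMap (ModuleCat.ofHom f)) i ≫ (torIso i N).inv :=
  ProjectiveResolution.leftDerived_app_eq
    ((MonoidalCategory.tensoringLeft (ModuleCat.{u} R)).map (ModuleCat.ofHom f))
    (projectiveResolution (ModuleCat.of R (IsLocalRing.ResidueField R))) i

lemma torMap_add (i : ℕ) (f g : M →ₗ[R] N) : torMap i (f + g) = torMap i f + torMap i g := by
  suffices h : ModuleCat.ofHom (torMap i (f + g)) = ModuleCat.ofHom (torMap i f + torMap i g) from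
    congrArg ModuleCat.Hom.hom h
  rw [ModuleCat.ofHom_add, torMap_eq, torMap_eq, torMap_eq]
  have : torComplexMap (ModuleCat.ofHom (f + g)) =
      torComplexMap (ModuleCat.ofHom f) + torComplexMap (ModuleCat.ofHom g) := by
    ext j : 1
    apply MonoidalPreadditive.add_whiskerRight
  rw [this, HomologicalComplex.homologyMap_add]
  simp

lemma torMap_zero (i : ℕ) : torMap i (0 : M →ₗ[R] N) = 0 := by
  have h := torMap_add i (0 : M →ₗ[R] N) 0
  rw [add_zero] at h
  exact (left_eq_add.mp h)

lemma torMap_sum (i : ℕ) {ι : Type*} (s : Finset ι) (f : ι → M →ₗ[R] N) :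
    torMap i (∑ j ∈ s, f j) = ∑ j ∈ s, torMap i (f j) := by
  classical
  induction s using Finset.induction_on with
  | empty => simp [torMap_zero]
  | insert a s ha ih => rw [Finset.sum_insert ha, Finset.sum_insert ha, torMap_add, ih]

/-- Isomorphic modules have isomorphic `Tor`. -/
noncomputable def torCongr (i : ℕ) (e : M ≃ₗ[R] N) : tor R i M ≃ₗ[R] tor R i N :=
  LinearEquiv.ofLinearMap (torMap i e.toLinearMap) (torMap i e.symm.toLinearMap)
    (by rw [← torMap_comp]; simp [torMap_id]) (by rw [← torMap_comp]; simp [torMap_id])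

instance flat_resolution (j : ℕ) : Module.Flat R
    ((projectiveResolution (ModuleCat.of R (IsLocalRing.ResidueField R))).complex.X j) := by
  have h := (projectiveResolution (ModuleCat.of R (IsLocalRing.ResidueField R))).projective j
  have : Module.Projective R
    ((projectiveResolution (ModuleCat.of R (IsLocalRing.ResidueField R))).complex.X j) :=
    (IsProjective.iff_projective _).mpr h
  infer_instance

/-- The short complex of complexes `M ⊗ P → N ⊗ P → Q ⊗ P`. -/
noncomputable def torShortComplex (f : M →ₗ[R] N) (g : N →ₗ[R] P) (h : g ∘ₗ f = 0) :
    ShortComplex (ChainComplex (ModuleCat.{u} R) ℕ) :=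
  ShortComplex.mk (torComplexMap (ModuleCat.ofHom f)) (torComplexMap (ModuleCat.ofHom g)) (by
    ext j : 1
    refine (MonoidalCategory.comp_whiskerRight _ _ _).symm.trans ?_
    rw [← ModuleCat.ofHom_comp, h]
    exact MonoidalPreadditive.zero_whiskerRight)

lemma torShortComplex_shortExact (f : M →ₗ[R] N) (g : N →ₗ[R] P) (hf : Function.Injective f)
    (hg : Function.Surjective g) (h : Function.Exact f g) :
    (torShortComplex f g h.linearMap_comp_eq_zero).ShortExact := by
  refine HomologicalComplex.shortExact_of_degreewise_shortExact _ fun j => ?_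
  set Q := (projectiveResolution (ModuleCat.of R (IsLocalRing.ResidueField R))).complex.X j
  refine ShortComplex.ShortExact.mk' ?_ ?_ ?_
  · rw [ShortComplex.ShortExact.moduleCat_exact_iff_function_exact]
    exact Module.Flat.rTensor_exact Q h
  · rw [ModuleCat.mono_iff_injective]
    exact Module.Flat.rTensor_preserves_injective_linearMap (M := Q) f hf
  · rw [ModuleCat.epi_iff_surjective]
    exact LinearMap.rTensor_surjective Q hg

lemma torIso_comp_torMap (i : ℕ) (f : M →ₗ[R] N) :
    (HomologicalComplex.homologyMap (torComplexMap (ModuleCat.ofHom f)) i).hom ∘ₗ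
      (torIso i M).toLinearEquiv.toLinearMap =
      (torIso i N).toLinearEquiv.toLinearMap ∘ₗ torMap i f := by
  have h := congrArg (fun φ => (φ ≫ (torIso i N).hom).hom) (torMap_eq i f)
  simp only [Category.assoc, Iso.inv_hom_id, Category.comp_id] at h
  exact h.symm

/-- The long exact sequence of `Tor(-, k)`: exactness at the middle term. -/
lemma torMap_exact (i : ℕ) (f : M →ₗ[R] N) (g : N →ₗ[R] P) (hf : Function.Injective f)
    (hg : Function.Surjective g) (h : Function.Exact f g) :
    Function.Exact (torMap i f) (torMap i g) := by
  have hS := (torShortComplex_shortExact f g hf hg h).homology_exact₂ i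
  rw [ShortComplex.ShortExact.moduleCat_exact_iff_function_exact] at hS
  exact (Function.Exact.iff_of_ladder_linearEquiv (torIso_comp_torMap i f)
    (torIso_comp_torMap i g)).mp hS

/-- The long exact sequence of `Tor(-, k)`: existence of the connecting map. -/
lemma exists_torConnecting (i : ℕ) (f : M →ₗ[R] N) (g : N →ₗ[R] P) (hf : Function.Injective f)
    (hg : Function.Surjective g) (h : Function.Exact f g) :
    ∃ δ : tor R (i + 1) P →ₗ[R] tor R i M,
      Function.Exact (torMap (i + 1) g) δ ∧ Function.Exact δ (torMap i f) := by
  have hS := torShortComplex_shortExact f g hf hg h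
  have h₁ := hS.homology_exact₁ (i + 1) i rfl
  have h₃ := hS.homology_exact₃ (i + 1) i rfl
  rw [ShortComplex.ShortExact.moduleCat_exact_iff_function_exact] at h₁ h₃
  let δ : tor R (i + 1) P →ₗ[R] tor R i M := (torIso i M).toLinearEquiv.symm.toLinearMap ∘ₗ
    (hS.δ (i + 1) i rfl).hom ∘ₗ (torIso (i + 1) P).toLinearEquiv.toLinearMap
  have hδ : (hS.δ (i + 1) i rfl).hom ∘ₗ (torIso (i + 1) P).toLinearEquiv.toLinearMap =
      (torIso i M).toLinearEquiv.toLinearMap ∘ₗ δ := by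
    ext x
    exact ((torIso i M).toLinearEquiv.apply_symm_apply _).symm
  exact ⟨δ, (Function.Exact.iff_of_ladder_linearEquiv (torIso_comp_torMap (i + 1) g) hδ).mp h₃,
    (Function.Exact.iff_of_ladder_linearEquiv hδ (torIso_comp_torMap i f)).mp h₁⟩

/-- `Tor_0^R(M, k) = M ⊗ k`. -/
noncomputable def torZeroEquiv (M : Type u) [AddCommGroup M] [Module R M] :
    tor R 0 M ≃ₗ[R] TensorProduct R M (IsLocalRing.ResidueField R) :=
  ((Functor.leftDerivedZeroIsoSelf
    ((MonoidalCategory.tensoringLeft (ModuleCat.{u} R)).obj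
      (ModuleCat.of R M))).app _).toLinearEquiv

lemma torMap_zero_surjective (g : N →ₗ[R] P) (hg : Function.Surjective g) :
    Function.Surjective (torMap 0 g) := by
  have h1 : Epi (torComplexMap (ModuleCat.ofHom g)) := by
    have : ∀ j, Epi ((torComplexMap (ModuleCat.ofHom g)).f j) := fun j => by
      rw [ModuleCat.epi_iff_surjective]
      exact LinearMap.rTensor_surjective _ hg
    exact HomologicalComplex.epi_of_epi_f _ this
  have h2 : Epi (HomologicalComplex.homologyMap (torComplexMap (ModuleCat.ofHom g)) 0) :=
    HomologicalComplex.epi_homologyMap_of_epi_of_not_rel _ _ (by simp)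
  have h3 : Epi (ModuleCat.ofHom (torMap 0 g)) := by
    rw [torMap_eq]
    infer_instance
  exact (ModuleCat.epi_iff_surjective _).mp h3

lemma subsingleton_tor_succ_of_flat (i : ℕ) [Module.Flat R M] : Subsingleton (tor R (i + 1) M) := by
  let Q := projectiveResolution (ModuleCat.of R (IsLocalRing.ResidueField R))
  have h1 : (torComplex (ModuleCat.of R M)).ExactAt (i + 1) := by
    have h2 := (Q.complex.exactAt_iff' (i + 2) (i + 1) i (by simp) (by simp)).mp
      (Q.complex_exactAt_succ i)
    rw [ShortComplex.ShortExact.moduleCat_exact_iff_function_exact] at h2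
    refine ((torComplex (ModuleCat.of R M)).exactAt_iff' (i + 2) (i + 1) i (by simp)
      (by simp)).mpr ?_
    rw [ShortComplex.ShortExact.moduleCat_exact_iff_function_exact]
    have h3 := Module.Flat.lTensor_exact M (f := (Q.complex.d (i + 2) (i + 1)).hom)
      (g := (Q.complex.d (i + 1) i).hom) h2
    exact h3
  have h3 := ((HomologicalComplex.exactAt_iff_isZero_homology _ _).mp h1).of_iso
    (torIso (i + 1) M)
  exact ModuleCat.subsingleton_of_isZero h3

end LocalTor

namespace LocalTor

open IsLocalRing TensorProduct

universe u

/-! ### Lengths and minimal presentations -/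

section Length

variable {R : Type*} [Ring R] {M N P : Type*} [AddCommGroup M] [Module R M] [AddCommGroup N]
  [Module R N] [AddCommGroup P] [Module R P]

lemma injective_of_surjective_of_length_le {f : M →ₗ[R] N} (hf : Function.Surjective f)
    (h : Module.length R M ≤ Module.length R N) (hN : Module.length R N ≠ ⊤) :
    Function.Injective f := by
  have h1 := Module.length_eq_add_of_exact (LinearMap.ker f).subtype f
    (Submodule.subtype_injective _) hf (LinearMap.exact_subtype_ker_map f)
  have h2 : Module.length R (LinearMap.ker f) = 0 := by
    rw [h1] at h
    have h3 : Module.length R (LinearMap.ker f) + Module.length R N ≤ 0 + Module.length R N := by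
      rwa [zero_add]
    exact le_antisymm ((ENat.add_le_add_iff_right hN).mp h3) zero_le
  rw [Module.length_eq_zero_iff] at h2
  rw [← LinearMap.ker_eq_bot]
  exact Submodule.subsingleton_iff_eq_bot.mp h2

lemma injective_of_exact_of_length_le {f : M →ₗ[R] N} {g : N →ₗ[R] P}
    (hg : Function.Surjective g) (h : Function.Exact f g)
    (hl : Module.length R M + Module.length R P ≤ Module.length R N)
    (hM : Module.length R M ≠ ⊤) (hP : Module.length R P ≠ ⊤) :
    Function.Injective f := by
  have h1 := Module.length_eq_add_of_exact (LinearMap.range f).subtype g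
    (Submodule.subtype_injective _) hg (fun x => by simpa using h x)
  rw [h1, ENat.add_le_add_iff_right hP] at hl
  have h2 := injective_of_surjective_of_length_le (LinearMap.surjective_rangeRestrict f) hl
    (ne_top_of_le_ne_top hM
      (Module.length_le_of_surjective _ (LinearMap.surjective_rangeRestrict f)))
  exact fun x y hxy => h2 (Subtype.ext hxy)

end Length

section Pi

variable {R M : Type*} [CommRing R] [AddCommGroup M] [Module R M]

lemma mem_smul_top_pi {n : ℕ} {x : Fin n → M} {I : Ideal R}
    (hx : ∀ i, x i ∈ (I • ⊤ : Submodule R M)) : x ∈ (I • ⊤ : Submodule R (Fin n → M)) := by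
  rw [← Finset.univ_sum_single x]
  refine Submodule.sum_mem _ fun i _ => ?_
  exact Submodule.smul_top_le_comap_smul_top I (LinearMap.single R (fun _ : Fin n => M) i) (hx i)

lemma apply_mem_of_mem_smul_top_pi {n : ℕ} {x : Fin n → M} {I : Ideal R}
    (hx : x ∈ (I • ⊤ : Submodule R (Fin n → M))) (i : Fin n) : x i ∈ (I • ⊤ : Submodule R M) := by
  exact Submodule.smul_top_le_comap_smul_top I (LinearMap.proj (R := R) (φ := fun _ => M) i) hx

end Pi

section Mu

variable {R : Type*} [CommRing R] [IsLocalRing R] {M N P : Type*} [AddCommGroup M] [Module R M]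
  [AddCommGroup N] [Module R N] [AddCommGroup P] [Module R P]

variable (R M) in
/-- The minimal number of generators of a finite module `M` over the local ring `R`, as the length
of `M / 𝔪M`. -/
noncomputable def mu : ℕ∞ :=
  Module.length R (M ⧸ (maximalIdeal R • ⊤ : Submodule R M))

lemma mu_eq_of_ker_le {f : M →ₗ[R] N} (hf : Function.Surjective f)
    (h : LinearMap.ker f ≤ maximalIdeal R • ⊤) : mu R M = mu R N := by
  have h1 : LinearMap.ker ((maximalIdeal R • ⊤ : Submodule R N).mkQ ∘ₗ f) =
      maximalIdeal R • ⊤ := by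
    rw [LinearMap.ker_comp, Submodule.ker_mkQ]
    have h2 : (maximalIdeal R • ⊤ : Submodule R N) =
        (maximalIdeal R • ⊤ : Submodule R M).map f := by
      rw [Submodule.map_smul'', Submodule.map_top, LinearMap.range_eq_top.mpr hf]
    rw [h2, Submodule.comap_map_eq, sup_eq_left.mpr h]
  exact ((Submodule.quotEquivOfEq _ _ h1.symm).trans (LinearMap.quotKerEquivOfSurjective _
    ((Submodule.mkQ_surjective _).comp hf))).length_eq

/-- Minimal numbers of generators are additive in `0 → M → N → P → 0` if `M ∩ 𝔪N = 𝔪M`. -/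
lemma mu_eq_add {f : M →ₗ[R] N} {g : N →ₗ[R] P} (hg : Function.Surjective g)
    (hfg : Function.Exact f g)
    (h : (maximalIdeal R • ⊤ : Submodule R N).comap f ≤ maximalIdeal R • ⊤) :
    mu R N = mu R M + mu R P := by
  refine Module.length_eq_add_of_exact
    (Submodule.mapQ _ _ f (Submodule.smul_top_le_comap_smul_top _ f))
    (Submodule.mapQ _ _ g (Submodule.smul_top_le_comap_smul_top _ g)) ?_ ?_ ?_
  · rw [← LinearMap.ker_eq_bot, eq_bot_iff]
    intro x hx
    obtain ⟨x, rfl⟩ := Submodule.mkQ_surjective _ x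
    have : f x ∈ (maximalIdeal R • ⊤ : Submodule R N) := by simpa using hx
    simpa using h this
  · intro y
    obtain ⟨y, rfl⟩ := Submodule.mkQ_surjective _ y
    obtain ⟨x, rfl⟩ := hg y
    exact ⟨Submodule.Quotient.mk x, by simp⟩
  · intro y
    obtain ⟨y, rfl⟩ := Submodule.mkQ_surjective _ y
    constructor
    · intro hy
      have hy' : g y ∈ (maximalIdeal R • ⊤ : Submodule R P) := by simpa using hy
      have h2 : (maximalIdeal R • ⊤ : Submodule R P) =
          (maximalIdeal R • ⊤ : Submodule R N).map g := by
        rw [Submodule.map_smul'', Submodule.map_top, LinearMap.range_eq_top.mpr hg]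
      rw [h2] at hy'
      obtain ⟨z, hz, hzy⟩ := hy'
      obtain ⟨x, hx⟩ := (hfg (y - z)).mp (by rw [map_sub, hzy, sub_self])
      refine ⟨Submodule.Quotient.mk x, ?_⟩
      rw [Submodule.mapQ_apply, hx, Submodule.mkQ_apply, Submodule.Quotient.eq]
      simpa using hz
    · rintro ⟨x, hx⟩
      obtain ⟨x, rfl⟩ := Submodule.mkQ_surjective _ x
      rw [← hx]
      simp [hfg.apply_apply_eq_zero]

lemma mu_eq_finrank [Module.Finite R M] :
    mu R M = Module.finrank (ResidueField R) (ResidueField R ⊗[R] M) := by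
  have h1 : Module.length R (ResidueField R ⊗[R] M) = mu R M :=
    (TensorProduct.quotTensorEquivQuotSMul M (maximalIdeal R)).length_eq
  rw [← h1, Module.length_eq_of_surjective (R := ResidueField R) residue_surjective,
    Module.length_eq_finrank]

lemma mu_ne_top [Module.Finite R M] : mu R M ≠ ⊤ := by
  rw [mu_eq_finrank]
  exact ENat.natCast_ne_top _

lemma mu_pi (n : ℕ) : mu R (Fin n → R) = n := by
  rw [mu_eq_finrank, Module.finrank_baseChange, Module.finrank_fin_fun]

lemma mu_pi_module (n : ℕ) : mu R (Fin n → M) = n * mu R M := by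
  let φ : (Fin n → M) →ₗ[R] (Fin n → M ⧸ (maximalIdeal R • ⊤ : Submodule R M)) :=
    LinearMap.pi fun i => (Submodule.mkQ _) ∘ₗ LinearMap.proj i
  have hφ : Function.Surjective φ := fun y => by
    choose x hx using fun i => Submodule.mkQ_surjective _ (y i)
    exact ⟨x, funext hx⟩
  have hker : LinearMap.ker φ = maximalIdeal R • ⊤ := by
    ext x
    rw [LinearMap.mem_ker]
    constructor
    · intro h
      refine mem_smul_top_pi fun i => ?_
      have := congrFun h i
      simpa [φ] using this
    · intro h
      funext i
      simpa [φ] using apply_mem_of_mem_smul_top_pi h i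
  unfold mu
  rw [← hker, (LinearMap.quotKerEquivOfSurjective φ hφ).length_eq, Module.length_pi]
  simp

variable (R M) in
/-- Every finite module over a local ring has a minimal presentation. -/
lemma exists_minimal_presentation [Module.Finite R M] :
    ∃ (n : ℕ) (π : (Fin n → R) →ₗ[R] M), (n : ℕ∞) = mu R M ∧ Function.Surjective π ∧
      ∀ x, π x = 0 → ∀ i, x i ∈ maximalIdeal R := by
  set b := Module.finBasis (ResidueField R) (ResidueField R ⊗[R] M)
  choose f hf using fun i =>
    TensorProduct.mk_surjective R M (ResidueField R) residue_surjective (b i)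
  refine ⟨_, Fintype.linearCombination R f, mu_eq_finrank.symm, ?_, ?_⟩
  · rw [← LinearMap.range_eq_top, Fintype.range_linearCombination]
    exact span_eq_top_of_tmul_eq_basis f b hf
  · intro x hx i
    have h1 : ∑ i, residue R (x i) • b i = 0 := by
      have h2 := congrArg (TensorProduct.mk R (ResidueField R) M 1) hx
      rw [Fintype.linearCombination_apply, map_sum, map_zero] at h2
      rw [← h2]
      refine Finset.sum_congr rfl fun j _ => ?_
      rw [map_smul, hf j]
      exact algebraMap_smul (ResidueField R) (x j) (b j)
    exact (residue_eq_zero_iff _).mp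
      (Fintype.linearIndependent_iff.mp b.linearIndependent (fun j => residue R (x j)) h1 i)

end Mu

/-! ### Betti numbers -/

section Betti

variable (R : Type u) [CommRing R] [IsLocalRing R] (M : Type u) [AddCommGroup M] [Module R M]

/-- The Betti number `β_i^R(M)`, as the length of `Tor_i^R(M, k)`. It is a natural number if `R` is
noetherian and `M` is finite. -/
noncomputable def bet (i : ℕ) : ℕ∞ := Module.length R (tor R i M)

variable {R M} {N P : Type u} [AddCommGroup N] [Module R N] [AddCommGroup P] [Module R P]

lemma bet_congr (e : M ≃ₗ[R] N) (i : ℕ) : bet R M i = bet R N i :=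
  (torCongr i e).length_eq

lemma bet_zero : bet R M 0 = mu R M :=
  ((torZeroEquiv M).trans ((TensorProduct.comm R M (ResidueField R)).trans
    (TensorProduct.quotTensorEquivQuotSMul M (maximalIdeal R)))).length_eq

lemma bet_ne_top [IsNoetherianRing R] [Module.Finite R M] (i : ℕ) : bet R M i ≠ ⊤ := by
  induction i generalizing M with
  | zero =>
    rw [bet_zero]
    exact mu_ne_top
  | succ i ih =>
    obtain ⟨n, π, -, hπ, -⟩ := exists_minimal_presentation R M
    obtain ⟨δ, h1, -⟩ := exists_torConnecting i (LinearMap.ker π).subtype π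
      (Submodule.subtype_injective _) hπ (LinearMap.exact_subtype_ker_map π)
    have := subsingleton_tor_succ_of_flat (R := R) (M := Fin n → R) i
    have hδ : Function.Injective δ := by
      rw [injective_iff_map_eq_zero]
      intro x hx
      obtain ⟨y, rfl⟩ := (h1 x).mp hx
      rw [Subsingleton.elim y 0, map_zero]
    exact ne_top_of_le_ne_top (ih (M := LinearMap.ker π)) (Module.length_le_of_injective δ hδ)

/-- Dimension shifting: the Betti numbers of `M` in positive degrees are those of its first syzygy
module, for a minimal presentation. -/
lemma bet_succ_of_exact {F : Type u} [AddCommGroup F] [Module R F] [Module.Flat R F]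
    [Module.Finite R M] {f : N →ₗ[R] F} {g : F →ₗ[R] M} (hf : Function.Injective f)
    (hg : Function.Surjective g) (h : Function.Exact f g) (hmin : mu R F = mu R M) (i : ℕ) :
    bet R M (i + 1) = bet R N i := by
  obtain ⟨δ, h1, h2⟩ := exists_torConnecting i f g hf hg h
  have := subsingleton_tor_succ_of_flat (R := R) (M := F) i
  have hδ : Function.Injective δ := by
    rw [injective_iff_map_eq_zero]
    intro x hx
    obtain ⟨y, rfl⟩ := (h1 x).mp hx
    rw [Subsingleton.elim y 0, map_zero]
  have h0 : ∀ x, torMap i f x = 0 := by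
    intro x
    cases i with
    | zero =>
      have hinj : Function.Injective (torMap 0 g) := by
        refine injective_of_surjective_of_length_le (torMap_zero_surjective g hg) ?_ ?_
        · exact ((bet_zero.trans hmin).trans bet_zero.symm).le
        · exact (bet_zero (R := R) (M := M)).trans_ne mu_ne_top
      apply hinj
      rw [map_zero]
      exact (torMap_exact 0 f g hf hg h).apply_apply_eq_zero x
    | succ i =>
      have := subsingleton_tor_succ_of_flat (R := R) (M := F) i
      exact Subsingleton.elim _ _
  exact (LinearEquiv.ofBijective δ ⟨hδ, fun x => (h2 x).mp (h0 x)⟩).length_eq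

lemma bet_self (i : ℕ) : bet R R i = if i = 0 then 1 else 0 := by
  cases i with
  | zero =>
    rw [bet_zero, mu_eq_finrank, Module.finrank_baseChange, Module.finrank_self]
    simp
  | succ i =>
    have := subsingleton_tor_succ_of_flat (R := R) (M := R) i
    simp [bet]

/-- `Tor` commutes with finite powers. -/
noncomputable def torPi (i n : ℕ) : tor R i (Fin n → M) ≃ₗ[R] (Fin n → tor R i M) :=
  LinearEquiv.ofLinearMap
    (LinearMap.pi fun j => torMap i (LinearMap.proj j))
    (∑ j, torMap i (LinearMap.single R (fun _ : Fin n => M) j) ∘ₗ LinearMap.proj j)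
    (by
      refine LinearMap.pi_ext' fun j => ?_
      ext x : 1
      funext l
      simp only [LinearMap.coe_comp, Function.comp_apply, LinearMap.pi_apply, LinearMap.sum_apply,
        LinearMap.coe_proj, Function.eval, map_sum, LinearMap.id_apply]
      simp only [← LinearMap.comp_apply, ← torMap_comp]
      rw [Finset.sum_eq_single j]
      · by_cases hl : l = j
        · subst hl
          rw [LinearMap.proj_comp_single_same, torMap_id, LinearMap.id_apply]
        · simp [LinearMap.proj_comp_single_ne, hl, torMap_zero]
      · intro b _ hb
        simp [hb]
      · simp)
    (by
      have h : (LinearMap.id : (Fin n → M) →ₗ[R] (Fin n → M)) =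
          ∑ j, LinearMap.single R (fun _ : Fin n => M) j ∘ₗ LinearMap.proj j := by
        refine LinearMap.ext fun x => ?_
        simp [LinearMap.sum_apply, Finset.univ_sum_single]
      rw [← torMap_id, h, torMap_sum]
      simp only [torMap_comp]
      ext x : 1
      simp [LinearMap.sum_apply])

lemma torPi_apply (i n : ℕ) (x : tor R i (Fin n → M)) (j : Fin n) :
    torPi i n x j = torMap i (LinearMap.proj j) x := rfl

lemma bet_pi (i n : ℕ) : bet R (Fin n → M) i = n * bet R M i := by
  unfold bet
  rw [(torPi i n).length_eq, Module.length_pi]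
  simp

end Betti

end LocalTor

namespace LocalTor

open IsLocalRing TensorProduct

universe u

/-! ### Change of rings along a surjection -/

section ResidueMap

variable {R S : Type u} [CommRing R] [CommRing S] [IsLocalRing S] [Algebra R S]

variable (R S) in
/-- The residue map `S → k` as a map of `R`-modules. -/
noncomputable def residueMap : S →ₗ[R] ResidueField S :=
  (Algebra.linearMap S (ResidueField S)).restrictScalars R

lemma residueMap_surjective : Function.Surjective (residueMap R S) := residue_surjective

end ResidueMap

section ChangeOfRings

variable {R S : Type u} [CommRing R] [IsLocalRing R] [CommRing S] [IsLocalRing S] [Algebra R S]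

lemma mu_eq_of_surjective (h : Function.Surjective (algebraMap R S)) (M : Type*) [AddCommGroup M]
    [Module R M] [Module S M] [IsScalarTower R S M] : mu R M = mu S M := by
  have h1 : (maximalIdeal R • ⊤ : Submodule R M) =
      (maximalIdeal S • ⊤ : Submodule S M).restrictScalars R := by
    rw [← IsLocalRing.map_maximalIdeal_of_surjective _ h, Ideal.smul_restrictScalars]
    rfl
  unfold mu
  rw [← Module.length_eq_of_surjective h]
  exact ((Submodule.quotEquivOfEq _ _ h1).trans
    (Submodule.Quotient.restrictScalarsEquiv R (maximalIdeal S • ⊤ : Submodule S M))).length_eq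

/-- If `Tor_i^R(S, k) → Tor_i^R(k, k)` is injective, then so is `Tor_i^R(Sⁿ, k) → Tor_i^R(M, k)` for
every minimal presentation `Sⁿ → M` over `S`, because `Sⁿ → kⁿ` factors through `M`. -/
lemma torMap_injective_of_presentation {i : ℕ}
    (hi : Function.Injective (torMap i (residueMap R S)))
    {M : Type u} [AddCommGroup M] [Module R M] [Module S M] [IsScalarTower R S M] {n : ℕ}
    (π : (Fin n → S) →ₗ[S] M) (hπ : Function.Surjective π)
    (hmin : ∀ x, π x = 0 → ∀ j, x j ∈ maximalIdeal S) :
    Function.Injective (torMap i (π.restrictScalars R)) := by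
  let ρ : (Fin n → S) →ₗ[S] (Fin n → ResidueField S) :=
    LinearMap.pi fun j => Algebra.linearMap S (ResidueField S) ∘ₗ LinearMap.proj j
  have hρ : LinearMap.ker π ≤ LinearMap.ker ρ := by
    intro x hx
    rw [LinearMap.mem_ker]
    funext j
    exact (residue_eq_zero_iff _).mpr (hmin x hx j)
  let ψ : M →ₗ[S] (Fin n → ResidueField S) := ((LinearMap.ker π).liftQ ρ hρ) ∘ₗ
    (LinearMap.quotKerEquivOfSurjective π hπ).symm.toLinearMap
  have hψ : ψ ∘ₗ π = ρ := by
    ext x : 1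
    have : (LinearMap.quotKerEquivOfSurjective π hπ).symm (π (LinearMap.single S _ x 1)) =
        Submodule.Quotient.mk (LinearMap.single S _ x 1) := by
      rw [LinearEquiv.symm_apply_eq]
      rfl
    ext j
    simp only [ψ, LinearMap.comp_apply, LinearEquiv.coe_coe, this]
    rfl
  rw [injective_iff_map_eq_zero]
  intro x hx
  have h1 : torMap i (ρ.restrictScalars R) x = 0 := by
    have : ρ.restrictScalars R = ψ.restrictScalars R ∘ₗ π.restrictScalars R := by
      rw [← hψ]; rfl
    rw [this, torMap_comp, LinearMap.comp_apply, hx, map_zero]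
  apply (torPi i n).injective
  rw [map_zero]
  funext j
  rw [torPi_apply]
  apply hi
  have h2 : residueMap R S ∘ₗ (LinearMap.proj j : (Fin n → S) →ₗ[R] S) =
      LinearMap.proj j ∘ₗ ρ.restrictScalars R := rfl
  rw [← LinearMap.comp_apply, ← torMap_comp, h2, torMap_comp, LinearMap.comp_apply, h1]
  simp

/-- The long exact sequence of a minimal presentation splits into short exact sequences where
`Tor^R(S, k) → Tor^R(k, k)` is injective. -/
lemma bet_succ_eq_add {i : ℕ}
    (hi : Function.Injective (torMap i (residueMap R S)))
    (hi' : Function.Injective (torMap (i + 1) (residueMap R S)))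
    {M : Type u} [AddCommGroup M] [Module R M] [Module S M] [IsScalarTower R S M] {n : ℕ}
    (π : (Fin n → S) →ₗ[S] M) (hπ : Function.Surjective π)
    (hmin : ∀ x, π x = 0 → ∀ j, x j ∈ maximalIdeal S) :
    bet R M (i + 1) = n * bet R S (i + 1) + bet R (LinearMap.ker π) i := by
  have hex : Function.Exact ((LinearMap.ker π).subtype.restrictScalars R) (π.restrictScalars R) :=
    LinearMap.exact_subtype_ker_map π
  have hN : Function.Injective ((LinearMap.ker π).subtype.restrictScalars R) :=
    Submodule.subtype_injective _
  obtain ⟨δ, h1, h2⟩ := exists_torConnecting i _ (π.restrictScalars R) hN hπ hex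
  rw [← bet_pi]
  refine Module.length_eq_add_of_exact _ δ
    (torMap_injective_of_presentation hi' π hπ hmin) (fun x => (h2 x).mp ?_) h1
  apply torMap_injective_of_presentation hi π hπ hmin
  rw [map_zero]
  exact (torMap_exact i _ _ hN hπ hex).apply_apply_eq_zero x

lemma smul_top_of_forall_mem {n : ℕ} {x : Fin n → S} (hx : ∀ i, x i ∈ maximalIdeal S) :
    x ∈ (maximalIdeal S • ⊤ : Submodule S (Fin n → S)) :=
  mem_smul_top_pi fun i => by simpa using hx i

/-- If `Tor_i^R(S, k) → Tor_i^R(k, k)` is injective for `i ≤ d`, then the Poincaré series satisfy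
`P_M^R = P_M^S P_S^R` up to degree `d`, for every finite `S`-module `M`. -/
theorem bet_eq_sum_of_injective [IsNoetherianRing S] (h : Function.Surjective (algebraMap R S))
    {d : ℕ} (hd : ∀ i ≤ d, Function.Injective (torMap i (residueMap R S))) (j : ℕ) (hj : j ≤ d)
    (M : Type u) [AddCommGroup M] [Module R M] [Module S M] [IsScalarTower R S M]
    [Module.Finite S M] :
    bet R M j = ∑ p ∈ Finset.HasAntidiagonal.antidiagonal j, bet S M p.1 * bet R S p.2 := by
  induction j generalizing M with
  | zero =>
    rw [Finset.Nat.antidiagonal_zero, Finset.sum_singleton, bet_zero, bet_zero, bet_zero,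
      mu_eq_of_surjective h M, mu_eq_of_surjective h S, ← bet_zero (M := S), bet_self]
    simp
  | succ j ih =>
    obtain ⟨n, π, hn, hπ, hmin⟩ := exists_minimal_presentation S M
    rw [bet_succ_eq_add (hd j (by omega)) (hd (j + 1) hj) π hπ hmin,
      ih (by omega) (LinearMap.ker π), Finset.Nat.sum_antidiagonal_succ, bet_zero (M := M), ← hn]
    congr 1
    refine Finset.sum_congr rfl fun p _ => ?_
    rw [bet_succ_of_exact (Submodule.subtype_injective (LinearMap.ker π)) hπ
      (LinearMap.exact_subtype_ker_map π)
      (mu_eq_of_ker_le hπ fun x hx => smul_top_of_forall_mem (hmin x hx))]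

lemma mu_residueField : mu S (ResidueField S) = 1 := by
  rw [← mu_eq_of_ker_le (f := Algebra.linearMap S (ResidueField S)) residue_surjective,
    ← bet_zero, bet_self, if_pos rfl]
  intro x hx
  simpa using (residue_eq_zero_iff x).mp hx

lemma exact_maximalIdeal_residue :
    Function.Exact (maximalIdeal S).subtype (Algebra.linearMap S (ResidueField S)) := by
  intro x
  rw [Algebra.linearMap_apply, ResidueField.algebraMap_eq, residue_eq_zero_iff]
  simp

lemma bet_residueField_succ (i : ℕ) :
    bet S (ResidueField S) (i + 1) = bet S (maximalIdeal S) i := by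
  have : Module.Finite S (ResidueField S) :=
    Module.Finite.of_surjective (Algebra.linearMap S (ResidueField S)) residue_surjective
  refine bet_succ_of_exact (Submodule.subtype_injective (maximalIdeal S))
    (g := Algebra.linearMap S (ResidueField S)) residue_surjective exact_maximalIdeal_residue ?_ i
  rw [mu_residueField, ← bet_zero, bet_self, if_pos rfl]

/-- If `P_k^R = P_k^S P_S^R` up to degree `d`, then `Tor_i^R(S, k) → Tor_i^R(k, k)` is injective for
`i ≤ d`: by induction, `Tor_i^R(S, k) → Tor_i^R(k, k) → Tor_{i-1}^R(𝔪, k) → 0` is exact, and the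
lengths of the outer terms add up to that of the middle one. -/
theorem torMap_residueMap_injective [IsNoetherianRing R] (h : Function.Surjective (algebraMap R S))
    {d : ℕ} (hd : ∀ j ≤ d, bet R (ResidueField S) j =
      ∑ p ∈ Finset.HasAntidiagonal.antidiagonal j, bet S (ResidueField S) p.1 * bet R S p.2) :
    ∀ i ≤ d, Function.Injective (torMap i (residueMap R S)) := by
  have : IsNoetherianRing S := isNoetherianRing_of_surjective R S _ h
  have hfin : Module.Finite R S :=
    Module.Finite.of_surjective (Algebra.linearMap R S) h
  have hfink : Module.Finite R (ResidueField S) :=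
    Module.Finite.of_surjective (residueMap R S) residueMap_surjective
  intro i
  induction i using Nat.strong_induction_on with
  | _ i ih =>
  intro hi
  rcases i with _ | i
  · refine injective_of_surjective_of_length_le (torMap_zero_surjective _ residueMap_surjective)
      (le_of_eq ?_) (bet_ne_top 0)
    exact (bet_zero.trans ((mu_eq_of_surjective h S).trans
      (bet_zero.symm.trans (bet_self 0)))).trans (mu_residueField.symm.trans
        ((mu_eq_of_surjective h _).symm.trans bet_zero.symm))
  · have hex : Function.Exact ((maximalIdeal S).subtype.restrictScalars R) (residueMap R S) :=
      exact_maximalIdeal_residue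
    have hN : Function.Injective ((maximalIdeal S).subtype.restrictScalars R) :=
      Submodule.subtype_injective _
    have : Module.Finite R (maximalIdeal S) := Module.Finite.trans S (maximalIdeal S)
    obtain ⟨δ, h1, h2⟩ := exists_torConnecting i _ (residueMap R S) hN residueMap_surjective hex
    have hδ : Function.Surjective δ := fun x => (h2 x).mp (by
      apply ih i (by omega) (by omega)
      rw [map_zero]
      exact (torMap_exact i _ _ hN residueMap_surjective hex).apply_apply_eq_zero x)
    refine injective_of_exact_of_length_le hδ h1 (le_of_eq ?_) (bet_ne_top _) (bet_ne_top _)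
    change bet R S (i + 1) + bet R (maximalIdeal S) i = bet R (ResidueField S) (i + 1)
    rw [hd (i + 1) hi, Finset.Nat.sum_antidiagonal_succ, bet_zero, mu_residueField, one_mul,
      bet_eq_sum_of_injective h (d := i) (fun j hj => ih j (by omega) (by omega)) i le_rfl]
    simp only [bet_residueField_succ]

/-- Truncated form of Levin's theorem on large homomorphisms: if `P_M^R = P_M^S P_S^R` holds up to
degree `d` for the residue field, then it does so for every finite `S`-module `M`. -/
theorem bet_eq_sum [IsNoetherianRing R] (h : Function.Surjective (algebraMap R S))
    {d : ℕ} (hd : ∀ j ≤ d, bet R (ResidueField S) j =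
      ∑ p ∈ Finset.HasAntidiagonal.antidiagonal j, bet S (ResidueField S) p.1 * bet R S p.2)
    (j : ℕ) (hj : j ≤ d) (M : Type u) [AddCommGroup M] [Module R M] [Module S M]
    [IsScalarTower R S M] [Module.Finite S M] :
    bet R M j = ∑ p ∈ Finset.HasAntidiagonal.antidiagonal j, bet S M p.1 * bet R S p.2 :=
  have : IsNoetherianRing S := isNoetherianRing_of_surjective R S _ h
  bet_eq_sum_of_injective h (torMap_residueMap_injective h hd) j hj M

end ChangeOfRings

end LocalTor

namespace LocalTor

open IsLocalRing TensorProduct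

universe u

/-! ### Algebra retracts -/

section Retract

lemma mu_prod {R M N : Type*} [CommRing R] [IsLocalRing R] [AddCommGroup M] [Module R M]
    [AddCommGroup N] [Module R N] : mu R (M × N) = mu R M + mu R N :=
  mu_eq_add (f := LinearMap.inl R M N) (g := LinearMap.snd R M N) LinearMap.snd_surjective .inl_snd
    fun _ hx => Submodule.smul_top_le_comap_smul_top _ (LinearMap.fst R M N) hx

variable {R S : Type u} [CommRing R] [IsLocalRing R] [CommRing S] [IsLocalRing S] [Algebra R S]

lemma bet_residueField_succ_of_surjective [IsNoetherianRing R]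
    (h : Function.Surjective (algebraMap R S)) (i : ℕ) :
    bet R (ResidueField S) (i + 1) = bet R (maximalIdeal R) i := by
  have hfink : Module.Finite R (ResidueField S) :=
    Module.Finite.of_surjective (residueMap R S ∘ₗ Algebra.linearMap R S)
      ((residueMap_surjective (R := R)).comp h)
  refine bet_succ_of_exact (Submodule.subtype_injective (maximalIdeal R))
    (g := residueMap R S ∘ₗ Algebra.linearMap R S) ((residueMap_surjective (R := R)).comp h) ?_ ?_ i
  · intro x
    have h1 : residueMap R S (Algebra.linearMap R S x) = 0 ↔ algebraMap R S x ∈ maximalIdeal S :=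
      residue_eq_zero_iff _
    have h2 : (maximalIdeal S).comap (algebraMap R S) = maximalIdeal R :=
      have := Function.Surjective.isLocalHom (algebraMap R S) h
      IsLocalRing.maximalIdeal_comap (algebraMap R S)
    rw [LinearMap.comp_apply, h1, ← Ideal.mem_comap, h2]
    simp
  · rw [mu_eq_of_surjective h (ResidueField S), mu_residueField, ← bet_zero, bet_self, if_pos rfl]

/-- The Betti numbers of `S = R / J` in positive degrees are those of `J`. -/
lemma bet_succ_of_surjective [IsNoetherianRing R] (h : Function.Surjective (algebraMap R S))
    (i : ℕ) : bet R S (i + 1) = bet R (RingHom.ker (algebraMap R S)) i := by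
  have : Module.Finite R S := Module.Finite.of_surjective (Algebra.linearMap R S) h
  refine bet_succ_of_exact (Submodule.subtype_injective (RingHom.ker (algebraMap R S)))
    (g := Algebra.linearMap R S) h (fun x => ?_) ?_ i
  · rw [Algebra.linearMap_apply, ← RingHom.mem_ker]
    simp
  · rw [mu_eq_of_surjective h S, ← bet_zero, ← bet_zero, bet_self, bet_self]

/-- If `R → S` is a retraction with section `s` and kernel `J`, then `P_k^R = P_k^S P_S^R` up to
degree two. The maximal ideal of `R` is minimally generated by the images under `s` of minimal
generators of `𝔪_S`, together with minimal generators of `J`; its syzygies are filtered, compatibly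
with minimal generators, by the syzygies of `J`, a power of `J`, and the syzygies of `𝔪_S`. -/
theorem bet_residueField_of_retract [IsNoetherianRing R] (s : S →+* R)
    (hs : ∀ x, algebraMap R S (s x) = x) (j : ℕ) (hj : j ≤ 2) :
    bet R (ResidueField S) j =
      ∑ p ∈ Finset.HasAntidiagonal.antidiagonal j, bet S (ResidueField S) p.1 * bet R S p.2 := by
  have hq : Function.Surjective (algebraMap R S) := fun x => ⟨s x, hs x⟩
  have hloc := Function.Surjective.isLocalHom (algebraMap R S) hq
  have : IsNoetherianRing S := isNoetherianRing_of_surjective R S _ hq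
  have hm : ∀ x, algebraMap R S x ∈ maximalIdeal S ↔ x ∈ maximalIdeal R := fun x => by
    rw [← IsLocalRing.maximalIdeal_comap (algebraMap R S), Ideal.mem_comap]
  set J := RingHom.ker (algebraMap R S) with hJ
  have hJm : J ≤ maximalIdeal R := fun x hx => by
    rw [← hm, (RingHom.mem_ker).mp hx]
    exact zero_mem _
  have he : ∀ x, x - s (algebraMap R S x) ∈ J := fun x => by
    rw [RingHom.mem_ker, map_sub, hs, sub_self]
  -- Minimal generators `b` of the maximal ideal of `S` and, through `ρ`, of `J`.
  obtain ⟨n, π, hn, hπ, hπm⟩ := exists_minimal_presentation S (maximalIdeal S)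
  obtain ⟨r, ρ, hr, hρ, hρm⟩ := exists_minimal_presentation R J
  let b : Fin n → S := fun i => (π (Pi.single i 1) : S)
  have hb : ∀ i, s (b i) ∈ maximalIdeal R := fun i => by
    rw [← hm, hs]
    exact (π (Pi.single i 1)).2
  have hπb : ∀ x, (π x : S) = ∑ i, x i * b i := fun x => by
    conv_lhs => rw [← Finset.univ_sum_single x, map_sum, AddSubmonoidClass.coe_finsetSum]
    refine Finset.sum_congr rfl fun i _ => ?_
    have : Pi.single i (x i) = x i • (Pi.single i 1 : Fin n → S) := by
      rw [← Pi.single_smul, smul_eq_mul, mul_one]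
    rw [this, map_smul]
    rfl
  let Φ₀ : (Fin n → R) →ₗ[R] R := Fintype.linearCombination R fun i => s (b i)
  have hΦ₀ : ∀ c, Φ₀ c = ∑ i, c i * s (b i) := fun c => rfl
  have hqΦ : ∀ c, algebraMap R S (Φ₀ c) = π fun i => algebraMap R S (c i) := fun c => by
    rw [hΦ₀, hπb, map_sum]
    simp [hs]
  let Φ : ((Fin n → R) × (Fin r → R)) →ₗ[R] maximalIdeal R :=
    LinearMap.codRestrict _ (Φ₀ ∘ₗ LinearMap.fst R _ _ + J.subtype ∘ₗ ρ ∘ₗ LinearMap.snd R _ _)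
      fun z => by
        refine add_mem ?_ (hJm (ρ z.2).2)
        rw [LinearMap.comp_apply, hΦ₀]
        exact sum_mem fun i _ => Ideal.mul_mem_left _ _ (hb i)
  have hΦ : ∀ z, (Φ z : R) = Φ₀ z.1 + ρ z.2 := fun z => rfl
  have hΦker : ∀ z, Φ z = 0 → π (fun i => algebraMap R S (z.1 i)) = 0 := fun z hz => by
    have h1 := congrArg (fun x : maximalIdeal R => algebraMap R S x) hz
    simp only [hΦ, map_add, hqΦ, ZeroMemClass.coe_zero, map_zero] at h1
    rw [(RingHom.mem_ker).mp (ρ z.2).2, add_zero] at h1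
    exact Subtype.ext h1
  have hcm : ∀ c : Fin n → R, π (fun i => algebraMap R S (c i)) = 0 → ∀ i, c i ∈ maximalIdeal R :=
    fun c hc i => (hm _).mp (hπm _ hc i)
  have hΦsurj : Function.Surjective Φ := by
    intro x
    obtain ⟨c, hc⟩ := hπ ⟨algebraMap R S x, (hm _).mpr x.2⟩
    have h1 : (x : R) - Φ₀ (fun i => s (c i)) ∈ J := by
      rw [RingHom.mem_ker, map_sub, hqΦ]
      simp only [hs]
      rw [hc, sub_self]
    obtain ⟨d, hd⟩ := hρ ⟨_, h1⟩
    refine ⟨(fun i => s (c i), d), Subtype.ext ?_⟩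
    rw [hΦ, hd]
    simp
  have hΦmin : LinearMap.ker Φ ≤ maximalIdeal R • ⊤ := by
    rintro ⟨c, d⟩ hz
    rw [LinearMap.mem_ker] at hz
    have hc := hΦker _ hz
    have h1 : ρ d ∈ (maximalIdeal R • ⊤ : Submodule R J) := by
      rw [Submodule.mem_smul_top_iff]
      have h2 : (ρ d : R) = -∑ i, (c i - s (algebraMap R S (c i))) * s (b i) := by
        have h3 : Φ₀ c + ρ d = 0 := congrArg Subtype.val hz
        have h4 : ∑ i, s (algebraMap R S (c i)) * s (b i) = 0 := by
          have := congrArg (fun x : maximalIdeal S => s x) hc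
          simpa [hπb, map_sum] using this
        simp only [sub_mul, Finset.sum_sub_distrib]
        rw [h4, sub_zero, ← hΦ₀, eq_neg_iff_add_eq_zero, add_comm]
        exact h3
      rw [h2]
      refine neg_mem (sum_mem fun i _ => ?_)
      rw [mul_comm]
      exact Submodule.smul_mem_smul (hb i) (he _)
    have h2 : d ∈ (maximalIdeal R • ⊤ : Submodule R (Fin r → R)) := by
      have h5 : (maximalIdeal R • ⊤ : Submodule R J) =
          (maximalIdeal R • ⊤ : Submodule R (Fin r → R)).map ρ := by
        rw [Submodule.map_smul'', Submodule.map_top, LinearMap.range_eq_top.mpr hρ]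
      rw [h5] at h1
      obtain ⟨d', hd', hdd⟩ := h1
      have h6 : d - d' ∈ (maximalIdeal R • ⊤ : Submodule R (Fin r → R)) :=
        smul_top_of_forall_mem (hρm _ (by rw [map_sub, hdd, sub_self]))
      simpa using add_mem h6 hd'
    have h3 : c ∈ (maximalIdeal R • ⊤ : Submodule R (Fin n → R)) :=
      smul_top_of_forall_mem (hcm c hc)
    have h4 : (c, d) = LinearMap.inl R _ _ c + LinearMap.inr R _ _ d := by simp
    rw [h4]
    exact add_mem (Submodule.smul_top_le_comap_smul_top _ (LinearMap.inl R _ _) h3)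
      (Submodule.smul_top_le_comap_smul_top _ (LinearMap.inr R _ _) h2)
  have hmuΦ := mu_eq_of_ker_le hΦsurj hΦmin
  have hbetm : bet R (maximalIdeal R) 1 = mu R (LinearMap.ker Φ) := by
    rw [bet_succ_of_exact (Submodule.subtype_injective (LinearMap.ker Φ)) hΦsurj
      (LinearMap.exact_subtype_ker_map Φ) hmuΦ, bet_zero]
  have hbetJ : bet R J 1 = mu R (LinearMap.ker ρ) := by
    rw [bet_succ_of_exact (Submodule.subtype_injective (LinearMap.ker ρ)) hρ
      (LinearMap.exact_subtype_ker_map ρ)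
      (mu_eq_of_ker_le hρ fun x hx => smul_top_of_forall_mem (hρm x hx)), bet_zero]
  have hbetS : bet S (maximalIdeal S) 1 = mu R (LinearMap.ker π) := by
    rw [bet_succ_of_exact (Submodule.subtype_injective (LinearMap.ker π)) hπ
      (LinearMap.exact_subtype_ker_map π)
      (mu_eq_of_ker_le hπ fun x hx => smul_top_of_forall_mem (hπm x hx)), bet_zero,
      mu_eq_of_surjective hq]
  -- The syzygies of the maximal ideal of `R` are filtered by the submodules `ker ρ` and `Jⁿ`,
  -- with last quotient `ker π`.
  let V : Submodule R (Fin n → R) :=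
    ((LinearMap.ker π).restrictScalars R).comap
      (LinearMap.pi fun i => Algebra.linearMap R S ∘ₗ LinearMap.proj i)
  have hV : ∀ c, c ∈ V ↔ π (fun i => algebraMap R S (c i)) = 0 := fun c => Iff.rfl
  have hmuU : mu R (LinearMap.ker Φ) = mu R (LinearMap.ker ρ) + mu R V := by
    let f : LinearMap.ker ρ →ₗ[R] LinearMap.ker Φ :=
      (LinearMap.inr R (Fin n → R) (Fin r → R)).restrict fun d hd => by
        rw [LinearMap.mem_ker] at hd ⊢
        exact Subtype.ext (by simp [hΦ, hd])
    let g : LinearMap.ker Φ →ₗ[R] V :=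
      (LinearMap.fst R (Fin n → R) (Fin r → R)).restrict fun z hz => hΦker z hz
    refine mu_eq_add (f := f) (g := g) ?_ ?_ ?_
    · rintro ⟨c, hc⟩
      have h1 : -Φ₀ c ∈ J := by
        rw [RingHom.mem_ker, map_neg, hqΦ, (hV c).mp hc]
        simp
      obtain ⟨d, hd⟩ := hρ ⟨_, h1⟩
      exact ⟨⟨(c, d), Subtype.ext (by simp [hΦ, hd])⟩, rfl⟩
    · rintro ⟨⟨c, d⟩, hz⟩
      constructor
      · intro h
        have hc : c = 0 := congrArg Subtype.val h
        subst hc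
        have hd : ρ d = 0 := by
          have := congrArg Subtype.val (show Φ (0, d) = 0 from hz)
          exact Subtype.ext (by simpa [hΦ] using this)
        exact ⟨⟨d, hd⟩, rfl⟩
      · rintro ⟨d', hd'⟩
        rw [← hd']
        rfl
    · -- Elements of `𝔪 • ker Φ` are moved into `𝔪 • ker ρ` by rewriting the difference between a
      -- coefficient `cᵢ` and its image in `s(S)` in terms of the generators of `J`.
      have key : ∀ z ∈ maximalIdeal R • LinearMap.ker Φ, ∀ E : Fin n → Fin r → R,
          (∀ i, (ρ (E i) : R) = z.1 i - s (algebraMap R S (z.1 i))) →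
          z.2 + ∑ i, s (b i) • E i ∈ maximalIdeal R • LinearMap.ker ρ := by
        intro z hz
        refine Submodule.smul_induction_on hz ?_ ?_
        · intro μ hμ z hz E hE
          choose E₀ hE₀ using fun i => hρ ⟨_, he (z.1 i)⟩
          obtain ⟨ν, hν⟩ := hρ ⟨_, he μ⟩
          have hν' : (ρ ν : R) = μ - s (algebraMap R S μ) := congrArg Subtype.val hν
          have hE₀' : ∀ i, (ρ (E₀ i) : R) = z.1 i - s (algebraMap R S (z.1 i)) :=
            fun i => congrArg Subtype.val (hE₀ i)
          have h4 : ∑ i, s (algebraMap R S (z.1 i)) * s (b i) = 0 := by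
            have := congrArg (fun x : maximalIdeal S => s x) (hΦker z hz)
            simpa [hπb, map_sum] using this
          have h5 : z.2 + ∑ i, s (b i) • E₀ i ∈ LinearMap.ker ρ := by
            rw [LinearMap.mem_ker]
            have h3 : Φ₀ z.1 + ρ z.2 = 0 := congrArg Subtype.val hz
            apply Subtype.ext
            simp only [map_add, map_sum, map_smul, Submodule.coe_add, Submodule.coe_smul,
              AddSubmonoidClass.coe_finsetSum, hE₀', smul_eq_mul, mul_sub,
              Finset.sum_sub_distrib, ZeroMemClass.coe_zero]
            simp only [mul_comm (s (b _))]
            rw [h4, sub_zero, ← hΦ₀, add_comm]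
            exact h3
          have h6 : ∀ i, E i - (μ • E₀ i + s (algebraMap R S (z.1 i)) • ν) ∈ LinearMap.ker ρ := by
            intro i
            rw [LinearMap.mem_ker]
            apply Subtype.ext
            simp only [map_sub, map_add, map_smul, Submodule.coe_sub, Submodule.coe_add,
              Submodule.coe_smul, hE, hE₀', hν', smul_eq_mul, ZeroMemClass.coe_zero,
              Prod.smul_fst, Pi.smul_apply, map_mul]
            ring
          have h7 : (μ • z).2 + ∑ i, s (b i) • E i = μ • (z.2 + ∑ i, s (b i) • E₀ i) +
              ∑ i, s (b i) • (E i - (μ • E₀ i + s (algebraMap R S (z.1 i)) • ν)) := by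
            have h8 : ∑ i, s (b i) • s (algebraMap R S (z.1 i)) • ν = 0 := by
              simp only [smul_smul, ← Finset.sum_smul]
              simp only [mul_comm (s (b _)), h4, zero_smul]
            simp only [smul_sub, smul_add, Finset.sum_sub_distrib, Finset.sum_add_distrib, h8,
              Finset.smul_sum, Prod.smul_snd, smul_comm μ (s (b _))]
            abel
          rw [h7]
          exact add_mem (Submodule.smul_mem_smul hμ h5)
            (sum_mem fun i _ => Submodule.smul_mem_smul (hb i) (h6 i))
        · intro z₁ z₂ h₁ h₂ E hE
          choose E₁ hE₁ using fun i => hρ ⟨_, he (z₁.1 i)⟩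
          have hE₁' : ∀ i, (ρ (E₁ i) : R) = z₁.1 i - s (algebraMap R S (z₁.1 i)) :=
            fun i => congrArg Subtype.val (hE₁ i)
          have h3 := add_mem (h₁ E₁ hE₁') (h₂ (fun i => E i - E₁ i) fun i => by
            simp only [map_sub, Submodule.coe_sub, hE, hE₁', Prod.fst_add, Pi.add_apply, map_add]
            ring)
          convert h3 using 1
          simp only [smul_sub, Finset.sum_sub_distrib, Prod.snd_add]
          abel
      intro d hd
      rw [Submodule.mem_comap, Submodule.mem_smul_top_iff] at hd
      rw [Submodule.mem_smul_top_iff]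
      have := key _ hd 0 (fun i => by simp [f])
      simpa [f] using this
  have hmuV : mu R V = n * mu R J + mu R (LinearMap.ker π) := by
    have hJV : ∀ y : Fin n → J, (fun i => (y i : R)) ∈ V := fun y => by
      rw [hV, ← map_zero π]
      congr 1
      funext i
      exact (RingHom.mem_ker).mp (y i).2
    let f : (Fin n → J) →ₗ[R] V :=
      LinearMap.codRestrict V (LinearMap.pi fun i => J.subtype ∘ₗ LinearMap.proj i) hJV
    let g : V →ₗ[R] LinearMap.ker π :=
      { toFun := fun c => ⟨fun i => algebraMap R S (c.1 i), c.2⟩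
        map_add' := fun c d => Subtype.ext (funext fun i => map_add _ _ _)
        map_smul' := fun x c => Subtype.ext (funext fun i => by
          simp [Algebra.smul_def]) }
    rw [← mu_pi_module]
    refine mu_eq_add (f := f) (g := g) ?_ ?_ ?_
    · rintro ⟨x, hx⟩
      refine ⟨⟨fun i => s (x i), ?_⟩, Subtype.ext (funext fun i => hs _)⟩
      rw [hV]
      simpa [hs] using hx
    · rintro ⟨c, hc⟩
      constructor
      · intro h
        have h1 : ∀ i, c i ∈ J := fun i => congrFun (congrArg Subtype.val h) i
        exact ⟨fun i => ⟨c i, h1 i⟩, rfl⟩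
      · rintro ⟨y, hy⟩
        rw [← hy]
        exact Subtype.ext (funext fun i => (RingHom.mem_ker).mp (y i).2)
    · have key : ∀ c ∈ maximalIdeal R • V, ∀ i,
          c i - s (algebraMap R S (c i)) ∈ maximalIdeal R • J := by
        intro c hc i
        refine Submodule.smul_induction_on hc ?_ ?_
        · intro μ hμ c hc
          have h1 : (μ • c) i - s (algebraMap R S ((μ • c) i)) =
              μ • (c i - s (algebraMap R S (c i))) +
                s (algebraMap R S (c i)) • (μ - s (algebraMap R S μ)) := by
            simp only [Pi.smul_apply, smul_eq_mul, map_mul]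
            ring
          rw [h1]
          refine add_mem (Submodule.smul_mem_smul hμ (he _)) (Submodule.smul_mem_smul ?_ (he _))
          rw [← hm, hs, hm]
          exact hcm c hc i
        · intro c₁ c₂ h₁ h₂
          have h3 := add_mem h₁ h₂
          convert h3 using 1
          simp only [Pi.add_apply, map_add]
          ring
      intro y hy
      rw [Submodule.mem_comap, Submodule.mem_smul_top_iff] at hy
      refine mem_smul_top_pi fun i => ?_
      rw [Submodule.mem_smul_top_iff]
      have h1 := key _ hy i
      have h2 : algebraMap R S (y i) = 0 := (RingHom.mem_ker).mp (y i).2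
      have h3 : (f y : Fin n → R) i = y i := rfl
      rwa [h3, h2, map_zero, sub_zero] at h1
  have h0 : bet R (ResidueField S) 0 = 1 := by
    rw [bet_zero, mu_eq_of_surjective hq, mu_residueField]
  have h0' : bet S (ResidueField S) 0 = 1 := by
    rw [bet_zero, mu_residueField]
  have h0'' : bet R S 0 = 1 := by
    rw [bet_zero, mu_eq_of_surjective hq, ← bet_zero, bet_self, if_pos rfl]
  interval_cases j
  · rw [Finset.Nat.antidiagonal_zero, Finset.sum_singleton, h0, h0', h0'', one_mul]
  · rw [Finset.Nat.sum_antidiagonal_succ, Finset.Nat.antidiagonal_zero, Finset.sum_singleton,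
      h0', h0'', bet_residueField_succ_of_surjective hq, bet_residueField_succ,
      bet_succ_of_surjective hq, bet_zero, bet_zero, bet_zero, ← hmuΦ, mu_prod, mu_pi, mu_pi, hn,
      hr, one_mul, mul_one, add_comm]
  · rw [Finset.Nat.sum_antidiagonal_succ, Finset.Nat.sum_antidiagonal_succ,
      Finset.Nat.antidiagonal_zero, Finset.sum_singleton,
      h0', h0'', bet_residueField_succ_of_surjective hq, bet_residueField_succ,
      bet_residueField_succ, bet_succ_of_surjective hq, bet_succ_of_surjective hq, hbetm, hmuU,
      hmuV, hbetJ, hbetS, bet_zero, bet_zero, ← hn, one_mul, mul_one]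

end Retract

end LocalTor

/-! ### Weighted norms of power series -/

namespace ConvergentSeries

open scoped ENNReal

variable {n : ℕ}

/-- The number `∏ pᵢ ^ aᵢ` attached to the exponent `a`, where `pᵢ` is the `i`-th prime number. It
is multiplicative in the monomial, and by unique factorization it separates monomials; so it orders
the monomials by a total order of type `ω`. -/
noncomputable def weight (a : Fin n →₀ ℕ) : ℕ := a.prod fun i k => Nat.nth Nat.Prime i ^ k

lemma weight_zero : weight (0 : Fin n →₀ ℕ) = 1 := Finsupp.prod_zero_index

lemma weight_add (a b : Fin n →₀ ℕ) : weight (a + b) = weight a * weight b :=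
  Finsupp.prod_add_index' (fun _ => pow_zero _) fun _ _ _ => pow_add _ _ _

lemma weight_pos (a : Fin n →₀ ℕ) : 0 < weight a :=
  Finset.prod_pos fun i _ => pow_pos (Nat.prime_nth_prime i).pos _

lemma weight_injective : Function.Injective (weight (n := n)) := by
  have h : ∀ a : Fin n →₀ ℕ, (weight a).factorization =
      a.embDomain ⟨fun i : Fin n => Nat.nth Nat.Prime i, fun i j hij =>
        Fin.ext (Nat.nth_injective Nat.infinite_setOfPred_prime hij)⟩ := by
    intro a
    rw [← Nat.prod_pow_factorization_eq_self (f := a.embDomain _), Finsupp.prod_embDomain]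
    · rfl
    · intro p hp
      rw [Finsupp.support_embDomain, Finset.mem_map] at hp
      obtain ⟨i, -, rfl⟩ := hp
      exact Nat.prime_nth_prime i
  intro a b hab
  exact Finsupp.embDomain_injective _ ((h a).symm.trans ((congrArg _ hab).trans (h b)))

lemma weight_eq_one_iff (a : Fin n →₀ ℕ) : weight a = 1 ↔ a = 0 :=
  ⟨fun h => weight_injective (h.trans weight_zero.symm), fun h => h ▸ weight_zero⟩

lemma two_pow_le_weight (a : Fin n →₀ ℕ) : 2 ^ a.degree ≤ weight a := by
  rw [Finsupp.degree_apply, ← Finset.prod_pow_eq_pow_sum]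
  exact Finset.prod_le_prod' fun i _ => Nat.pow_le_pow_left (Nat.prime_nth_prime i).two_le _

lemma exists_weight_le (n : ℕ) : ∃ P : ℕ, 0 < P ∧ ∀ a : Fin n →₀ ℕ, weight a ≤ P ^ a.degree := by
  refine ⟨∑ i : Fin n, Nat.nth Nat.Prime i + 1, Nat.succ_pos _, fun a => ?_⟩
  rw [Finsupp.degree_apply, ← Finset.prod_pow_eq_pow_sum]
  refine Finset.prod_le_prod' fun i _ => Nat.pow_le_pow_left (Nat.le_succ_of_le ?_) _
  exact Finset.single_le_sum (f := fun i : Fin n => Nat.nth Nat.Prime i) (fun _ _ => Nat.zero_le _)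
    (Finset.mem_univ i)

/-- The norm `∑ ‖f_a‖ weight(a) ^ (-t)` of a power series: it is the value of the Dirichlet
series with coefficients `‖f_a‖`, and is dominated by the contribution of the terms of least weight
for `t → ∞`. -/
noncomputable def wnorm (t : ℕ) (f : MvPowerSeries (Fin n) ℂ) : ℝ≥0∞ :=
  ∑' a, ‖MvPowerSeries.coeff a f‖ₑ * ((weight a : ℝ≥0∞) ^ t)⁻¹

lemma weight_pow_ne_zero (a : Fin n →₀ ℕ) (t : ℕ) : (weight a : ℝ≥0∞) ^ t ≠ 0 :=
  pow_ne_zero _ (Nat.cast_ne_zero.mpr (weight_pos a).ne')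

lemma weight_pow_ne_top (a : Fin n →₀ ℕ) (t : ℕ) : (weight a : ℝ≥0∞) ^ t ≠ ⊤ :=
  ENNReal.pow_ne_top (ENNReal.natCast_ne_top _)

lemma inv_weight_pow_add (a b : Fin n →₀ ℕ) (t : ℕ) :
    ((weight (a + b) : ℝ≥0∞) ^ t)⁻¹ = ((weight a : ℝ≥0∞) ^ t)⁻¹ * ((weight b : ℝ≥0∞) ^ t)⁻¹ := by
  rw [weight_add, Nat.cast_mul, mul_pow, ENNReal.mul_inv (Or.inl (weight_pow_ne_zero a t))
    (Or.inl (weight_pow_ne_top a t))]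

lemma wnorm_add_le (t : ℕ) (f g : MvPowerSeries (Fin n) ℂ) :
    wnorm t (f + g) ≤ wnorm t f + wnorm t g := by
  unfold wnorm
  rw [← ENNReal.tsum_add]
  refine ENNReal.tsum_le_tsum fun a => ?_
  rw [map_add, ← add_mul]
  gcongr
  exact enorm_add_le _ _

lemma wnorm_neg (t : ℕ) (f : MvPowerSeries (Fin n) ℂ) : wnorm t (-f) = wnorm t f := by
  simp [wnorm]

lemma wnorm_zero (t : ℕ) : wnorm t (0 : MvPowerSeries (Fin n) ℂ) = 0 := by
  simp [wnorm]

lemma wnorm_sum_le (t : ℕ) {ι : Type*} (s : Finset ι) (f : ι → MvPowerSeries (Fin n) ℂ) :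
    wnorm t (∑ i ∈ s, f i) ≤ ∑ i ∈ s, wnorm t (f i) := by
  classical
  induction s using Finset.induction_on with
  | empty => simp [wnorm_zero]
  | insert a s ha ih =>
    rw [Finset.sum_insert ha, Finset.sum_insert ha]
    exact (wnorm_add_le _ _ _).trans (by gcongr)

lemma wnorm_one (t : ℕ) : wnorm t (1 : MvPowerSeries (Fin n) ℂ) = 1 := by
  classical
  unfold wnorm
  rw [tsum_eq_single 0 fun a ha => by rw [MvPowerSeries.coeff_one, if_neg ha]; simp]
  simp [weight_zero]

lemma wnorm_mul_le (t : ℕ) (f g : MvPowerSeries (Fin n) ℂ) :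
    wnorm t (f * g) ≤ wnorm t f * wnorm t g := by
  classical
  unfold wnorm
  rw [← ENNReal.tsum_mul_left]
  simp_rw [← ENNReal.tsum_mul_right]
  rw [← ENNReal.tsum_prod (f := fun a b => ‖MvPowerSeries.coeff b f‖ₑ * ((weight b : ℝ≥0∞) ^ t)⁻¹ *
      (‖MvPowerSeries.coeff a g‖ₑ * ((weight a : ℝ≥0∞) ^ t)⁻¹)),
    ← (Equiv.prodComm _ _).tsum_eq,
    ← Finset.HasAntidiagonal.sigmaAntidiagonalEquivProd.tsum_eq, ENNReal.tsum_sigma']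
  refine ENNReal.tsum_le_tsum fun a => ?_
  rw [tsum_fintype, MvPowerSeries.coeff_mul,
    ← Finset.sum_attach (Finset.HasAntidiagonal.antidiagonal a)]
  refine (mul_le_mul_left (enorm_sum_le _ _) _).trans ?_
  rw [Finset.sum_mul]
  refine Finset.sum_le_sum fun p _ => le_of_eq ?_
  have h := inv_weight_pow_add p.1.1 p.1.2 t
  rw [Finset.HasAntidiagonal.mem_antidiagonal.mp p.2] at h
  rw [enorm_mul, h]
  simp only [Finset.HasAntidiagonal.sigmaAntidiagonalEquivProd_apply, Equiv.prodComm_apply,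
    Prod.fst_swap, Prod.snd_swap]
  ring

lemma wnorm_pow_le (t : ℕ) (f : MvPowerSeries (Fin n) ℂ) (k : ℕ) :
    wnorm t (f ^ k) ≤ wnorm t f ^ k := by
  induction k with
  | zero => simp [wnorm_one]
  | succ k ih =>
    rw [pow_succ, pow_succ]
    exact (wnorm_mul_le _ _ _).trans (by gcongr)

/-- The norm decays exponentially in `t` if the terms of small weight vanish. -/
lemma wnorm_add_le_of_coeff {f : MvPowerSeries (Fin n) ℂ} {A : ℕ}
    (h : ∀ a, weight a < A → MvPowerSeries.coeff a f = 0) (t s : ℕ) :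
    wnorm (t + s) f ≤ ((A : ℝ≥0∞) ^ s)⁻¹ * wnorm t f := by
  unfold wnorm
  rw [← ENNReal.tsum_mul_left]
  refine ENNReal.tsum_le_tsum fun a => ?_
  by_cases ha : weight a < A
  · simp [h a ha]
  · rw [pow_add, ENNReal.mul_inv (Or.inl (weight_pow_ne_zero a t))
      (Or.inl (weight_pow_ne_top a t))]
    calc _ = ((weight a : ℝ≥0∞) ^ s)⁻¹ * (‖MvPowerSeries.coeff a f‖ₑ *
          ((weight a : ℝ≥0∞) ^ t)⁻¹) := by ring
      _ ≤ _ := by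
        gcongr
        exact not_lt.mp ha

lemma wnorm_antitone (f : MvPowerSeries (Fin n) ℂ) {t t' : ℕ} (h : t ≤ t') :
    wnorm t' f ≤ wnorm t f := by
  obtain ⟨s, rfl⟩ := Nat.exists_eq_add_of_le h
  refine (wnorm_add_le_of_coeff (A := 1) (fun a ha => ?_) t s).trans (by simp)
  exact absurd (weight_pos a) (by omega)

lemma isConvergentSeries_iff {f : MvPowerSeries (Fin n) ℂ} :
    IsConvergentSeries f ↔ ∃ t, wnorm t f ≠ ⊤ := by
  have key : ∀ (r : ℝ), 0 ≤ r → ((Summable fun a : Fin n →₀ ℕ =>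
      ‖MvPowerSeries.coeff a f‖ * r ^ a.degree) ↔
      ∑' a, ‖MvPowerSeries.coeff a f‖ₑ * ENNReal.ofReal r ^ a.degree ≠ ⊤) := by
    intro r hr
    have h1 : ∀ a, ‖MvPowerSeries.coeff a f‖ₑ * ENNReal.ofReal r ^ a.degree =
        ENNReal.ofReal (‖MvPowerSeries.coeff a f‖ * r ^ a.degree) := fun a => by
      rw [ENNReal.ofReal_mul (norm_nonneg _), ENNReal.ofReal_pow hr, ofReal_norm]
    simp_rw [h1]
    exact ⟨fun h => h.tsum_ofReal_ne_top, fun h => by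
      have := ENNReal.summable_toReal h
      refine this.congr fun a => ENNReal.toReal_ofReal (by positivity)⟩
  constructor
  · rintro ⟨r, hr, h⟩
    obtain ⟨t, ht⟩ := exists_pow_lt_of_lt_one hr (y := (1 / 2 : ℝ)) (by norm_num)
    refine ⟨t, ne_top_of_le_ne_top ((key r hr.le).mp h) (ENNReal.tsum_le_tsum fun a => ?_)⟩
    gcongr
    have h2 : (2 ^ t : ℝ≥0∞)⁻¹ ≤ ENNReal.ofReal r := by
      rw [← ENNReal.ofReal_ofNat 2, ← ENNReal.ofReal_pow (by norm_num),
        ← ENNReal.ofReal_inv_of_pos (by positivity)]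
      apply ENNReal.ofReal_le_ofReal
      rw [← inv_pow]
      norm_num at ht ⊢
      exact ht.le
    calc ((weight a : ℝ≥0∞) ^ t)⁻¹ ≤ (((2 ^ a.degree : ℕ) : ℝ≥0∞) ^ t)⁻¹ := by
          gcongr
          exact two_pow_le_weight a
      _ = ((2 ^ t : ℝ≥0∞)⁻¹) ^ a.degree := by
          rw [← ENNReal.inv_pow, Nat.cast_pow, ← pow_mul, ← pow_mul, mul_comm]
          simp
      _ ≤ _ := by gcongr
  · rintro ⟨t, ht⟩
    obtain ⟨P, hP, hw⟩ := exists_weight_le n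
    refine ⟨((P : ℝ) ^ t)⁻¹, by positivity, (key _ (by positivity)).mpr
      (ne_top_of_le_ne_top ht (ENNReal.tsum_le_tsum fun a => ?_))⟩
    gcongr
    rw [ENNReal.ofReal_inv_of_pos (by positivity), ENNReal.ofReal_pow (by positivity),
      ENNReal.ofReal_natCast, ← ENNReal.inv_pow, ← pow_mul, mul_comm t, pow_mul,
      ENNReal.inv_le_inv]
    gcongr
    exact_mod_cast hw a

end ConvergentSeries

/-! ### Division with remainder and noetherianity of the ring of convergent power series -/

namespace ConvergentSeries

open scoped ENNReal
open Filter Topology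

variable {n : ℕ}

lemma eventually_wnorm_ne_top {f : MvPowerSeries (Fin n) ℂ} (hf : IsConvergentSeries f) :
    ∀ᶠ t in atTop, wnorm t f ≠ ⊤ := by
  obtain ⟨t, ht⟩ := isConvergentSeries_iff.mp hf
  filter_upwards [eventually_ge_atTop t] with t' h
  exact ne_top_of_le_ne_top ht (wnorm_antitone f h)

/-- If all the terms of `f` have weight at least `B > A`, then `f` is negligible against a term of
weight `A`. -/
lemma eventually_wnorm_le {f : MvPowerSeries (Fin n) ℂ} (hf : IsConvergentSeries f) {A B : ℕ}
    (hA : 0 < A) (hAB : A < B) (h : ∀ a, weight a < B → MvPowerSeries.coeff a f = 0) {ε : ℝ≥0∞}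
    (hε : ε ≠ 0) : ∀ᶠ t in atTop, wnorm t f ≤ ε * ((A : ℝ≥0∞) ^ t)⁻¹ := by
  obtain ⟨t, ht⟩ := isConvergentSeries_iff.mp hf
  have hA0 : (A : ℝ≥0∞) ≠ 0 := Nat.cast_ne_zero.mpr hA.ne'
  have hA1 : (A : ℝ≥0∞) ≠ ⊤ := ENNReal.natCast_ne_top A
  have hB0 : (B : ℝ≥0∞) ≠ 0 := Nat.cast_ne_zero.mpr (hA.trans hAB).ne'
  have hr : (A : ℝ≥0∞) / B < 1 := by
    rw [ENNReal.div_lt_iff (Or.inl hB0) (Or.inl (ENNReal.natCast_ne_top B)), one_mul]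
    exact_mod_cast hAB
  have h1 := ENNReal.Tendsto.mul_const (b := wnorm t f * (A : ℝ≥0∞) ^ t)
    (ENNReal.tendsto_pow_atTop_nhds_zero_of_lt_one hr)
    (Or.inr (ENNReal.mul_ne_top ht (ENNReal.pow_ne_top hA1)))
  rw [zero_mul] at h1
  have h2 := h1.eventually_lt_const (pos_iff_ne_zero.mpr hε)
  obtain ⟨s₀, hs₀⟩ := eventually_atTop.mp h2
  filter_upwards [eventually_ge_atTop (t + s₀)] with t' ht'
  obtain ⟨s, rfl⟩ := Nat.exists_eq_add_of_le ((Nat.le_add_right t s₀).trans ht')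
  have h3 := (hs₀ s (by omega)).le
  refine (wnorm_add_le_of_coeff h t s).trans ?_
  rw [← ENNReal.div_eq_inv_mul]
  have h4 : (A : ℝ≥0∞) ^ (t + s) ≠ 0 := pow_ne_zero _ hA0
  have h5 : (A : ℝ≥0∞) ^ (t + s) ≠ ⊤ := ENNReal.pow_ne_top hA1
  rw [← div_eq_mul_inv, ENNReal.le_div_iff_mul_le (Or.inl h4) (Or.inl h5)]
  refine le_of_eq_of_le ?_ h3
  rw [div_eq_mul_inv, div_eq_mul_inv, mul_pow, pow_add, ENNReal.inv_pow]
  ring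

/-- A coefficientwise continuous operator `T` on power series of norm at most `1 / 2` admits
solutions of `H = f + T H`, given by the Neumann series `∑ T ^ k f`. -/
lemma exists_eq_add_apply {t : ℕ} {f : MvPowerSeries (Fin n) ℂ} (hft : wnorm t f ≠ ⊤)
    (T : MvPowerSeries (Fin n) ℂ → MvPowerSeries (Fin n) ℂ)
    (hT : ∀ h, wnorm t (T h) ≤ 2⁻¹ * wnorm t h)
    (hTs : ∀ (h : ℕ → MvPowerSeries (Fin n) ℂ) (H : MvPowerSeries (Fin n) ℂ),
      (∀ b, HasSum (fun k => MvPowerSeries.coeff b (h k)) (MvPowerSeries.coeff b H)) →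
      ∀ b, HasSum (fun k => MvPowerSeries.coeff b (T (h k))) (MvPowerSeries.coeff b (T H))) :
    ∃ H, wnorm t H ≠ ⊤ ∧ H = f + T H := by
  let h : ℕ → MvPowerSeries (Fin n) ℂ := fun k => T^[k] f
  have hh : ∀ k, h (k + 1) = T (h k) := fun k => Function.iterate_succ_apply' T k f
  have hnorm : ∀ k, wnorm t (h k) ≤ 2⁻¹ ^ k * wnorm t f := by
    intro k
    induction k with
    | zero => simp [h]
    | succ k ih =>
      rw [hh, pow_succ', mul_assoc]
      exact (hT _).trans (by gcongr)
  have hsumnorm : ∑' k, wnorm t (h k) ≠ ⊤ := by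
    refine ne_top_of_le_ne_top ?_ (ENNReal.tsum_le_tsum hnorm)
    rw [ENNReal.tsum_mul_right, ENNReal.tsum_geometric]
    exact ENNReal.mul_ne_top (by simp) hft
  have hcomm : ∑' b, (∑' k, ‖MvPowerSeries.coeff b (h k)‖ₑ) * ((weight b : ℝ≥0∞) ^ t)⁻¹ =
      ∑' k, wnorm t (h k) := by
    unfold wnorm
    rw [ENNReal.tsum_comm]
    simp_rw [ENNReal.tsum_mul_right]
  have hsummable : ∀ b, Summable fun k => ‖MvPowerSeries.coeff b (h k)‖ := by
    intro b
    have h1 : ∑' k, ‖MvPowerSeries.coeff b (h k)‖ₑ ≠ ⊤ := by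
      intro h2
      apply hsumnorm
      rw [← hcomm, ← top_le_iff]
      refine le_trans ?_ (ENNReal.le_tsum b)
      rw [h2, ENNReal.top_mul (ENNReal.inv_ne_zero.mpr (weight_pow_ne_top b t))]
    refine (ENNReal.summable_toReal h1).congr fun k => toReal_enorm _
  let H : MvPowerSeries (Fin n) ℂ := fun b => ∑' k, MvPowerSeries.coeff b (h k)
  have hHs : ∀ b, HasSum (fun k => MvPowerSeries.coeff b (h k)) (MvPowerSeries.coeff b H) :=
    fun b => (hsummable b).of_norm.hasSum
  have hHnorm : wnorm t H ≠ ⊤ := by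
    refine ne_top_of_le_ne_top hsumnorm ?_
    rw [← hcomm]
    refine ENNReal.tsum_le_tsum fun b => ?_
    gcongr
    have h1 : ∑' k, ‖MvPowerSeries.coeff b (h k)‖ₑ =
        ENNReal.ofReal (∑' k, ‖MvPowerSeries.coeff b (h k)‖) := by
      rw [ENNReal.ofReal_tsum_of_nonneg (fun _ => norm_nonneg _) (hsummable b)]
      simp
    rw [h1, ← ofReal_norm]
    exact ENNReal.ofReal_le_ofReal (norm_tsum_le_tsum_norm (hsummable b))
  refine ⟨H, hHnorm, ?_⟩
  ext c
  have h1 := hTs h H hHs c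
  simp only [← hh] at h1
  have h2 := (hasSum_nat_add_iff (f := fun k => MvPowerSeries.coeff c (h k)) 1).mp h1
  rw [(hHs c).unique h2, map_add, add_comm]
  simp [h]

open Classical in
/-- Grauert's division theorem: a convergent power series can be divided by finitely many convergent
power series `g a` with leading exponents `a ∈ A`; no multiple of a leading monomial occurs in the
remainder. -/
theorem exists_division (A : Finset (Fin n →₀ ℕ)) (g : (Fin n →₀ ℕ) → MvPowerSeries (Fin n) ℂ)
    (hg : ∀ a ∈ A, IsConvergentSeries (g a)) (hlead : ∀ a ∈ A, MvPowerSeries.coeff a (g a) = 1)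
    (hlt : ∀ a ∈ A, ∀ b, b ≠ a → MvPowerSeries.coeff b (g a) ≠ 0 → weight a < weight b)
    {f : MvPowerSeries (Fin n) ℂ} (hf : IsConvergentSeries f) :
    ∃ q : (Fin n →₀ ℕ) → MvPowerSeries (Fin n) ℂ, (∀ a ∈ A, IsConvergentSeries (q a)) ∧
      ∀ b, (∃ a ∈ A, a ≤ b) → MvPowerSeries.coeff b (f - ∑ a ∈ A, q a * g a) = 0 := by
  -- `G a` is `g a` without its leading term.
  let G : (Fin n →₀ ℕ) → MvPowerSeries (Fin n) ℂ := fun a => g a - MvPowerSeries.monomial a 1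
  have hGc : ∀ a ∈ A, IsConvergentSeries (G a) := fun a ha => by
    have h1 : IsConvergentSeries (MvPowerSeries.monomial a (1 : ℂ)) := by
      refine ⟨1, one_pos, summable_of_ne_finset_zero (s := {a}) fun b hb => ?_⟩
      rw [MvPowerSeries.coeff_monomial_ne (by simpa using hb)]
      simp
    exact (ConvergentSeries n).sub_mem (hg a ha) h1
  have hGz : ∀ a ∈ A, ∀ b, weight b < weight a + 1 → MvPowerSeries.coeff b (G a) = 0 := by
    intro a ha b hb
    rw [map_sub]
    by_cases hba : b = a
    · rw [hba, hlead a ha, MvPowerSeries.coeff_monomial_same, sub_self]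
    · rw [MvPowerSeries.coeff_monomial_ne hba, sub_zero]
      by_contra h0
      have := hlt a ha b hba h0
      omega
  obtain ⟨t, hft, hGt⟩ : ∃ t, wnorm t f ≠ ⊤ ∧
      ∀ a ∈ A, wnorm t (G a) ≤ 2⁻¹ * ((weight a : ℝ≥0∞) ^ t)⁻¹ :=
    ((eventually_wnorm_ne_top hf).and ((eventually_all_finset A).mpr fun a ha =>
      eventually_wnorm_le (hGc a ha) (weight_pos a) (Nat.lt_succ_self _) (hGz a ha)
        (by simp))).exists
  let D : (Fin n →₀ ℕ) → Prop := fun b => ∃ a ∈ A, a ≤ b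
  let sel : (Fin n →₀ ℕ) → (Fin n →₀ ℕ) := fun b => if h : D b then h.choose else 0
  have hsel : ∀ b, D b → sel b ∈ A ∧ sel b ≤ b := fun b h => by
    simp only [sel, dif_pos h]
    exact h.choose_spec
  -- The quotient by the leading monomial `a` collects the terms of exponents `b` with `sel b = a`.
  let q : (Fin n →₀ ℕ) → MvPowerSeries (Fin n) ℂ → MvPowerSeries (Fin n) ℂ := fun a h c =>
    if D (c + a) ∧ sel (c + a) = a then MvPowerSeries.coeff (c + a) h else 0
  have hq : ∀ a h c, MvPowerSeries.coeff c (q a h) =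
    if D (c + a) ∧ sel (c + a) = a then MvPowerSeries.coeff (c + a) h else 0 := fun a h c => rfl
  have hqnorm : ∀ a h, wnorm t (q a h) * ((weight a : ℝ≥0∞) ^ t)⁻¹ ≤
      ∑' b, if D b ∧ sel b = a then
        ‖MvPowerSeries.coeff b h‖ₑ * ((weight b : ℝ≥0∞) ^ t)⁻¹ else 0 := by
    intro a h
    unfold wnorm
    rw [← ENNReal.tsum_mul_right]
    refine le_trans (ENNReal.tsum_le_tsum fun c => ?_)
      (ENNReal.tsum_comp_le_tsum_of_injective (add_left_injective a) _)
    simp only [hq]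
    split_ifs with hc
    · rw [mul_assoc, ← inv_weight_pow_add]
    · simp
  have hqsum : ∀ h, ∑ a ∈ A, wnorm t (q a h) * ((weight a : ℝ≥0∞) ^ t)⁻¹ ≤ wnorm t h := by
    intro h
    refine (Finset.sum_le_sum fun a _ => hqnorm a h).trans ?_
    rw [← Summable.tsum_finsetSum fun _ _ => ENNReal.summable]
    refine ENNReal.tsum_le_tsum fun b => ?_
    by_cases hb : D b
    · simp only [hb, true_and]
      rw [Finset.sum_ite_eq, if_pos (hsel b hb).1]
    · simp [hb]
  let T : MvPowerSeries (Fin n) ℂ → MvPowerSeries (Fin n) ℂ := fun h => -∑ a ∈ A, q a h * G a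
  have hT : ∀ h, wnorm t (T h) ≤ 2⁻¹ * wnorm t h := by
    intro h
    rw [wnorm_neg]
    calc _ ≤ ∑ a ∈ A, wnorm t (q a h * G a) := wnorm_sum_le _ _ _
      _ ≤ ∑ a ∈ A, 2⁻¹ * (wnorm t (q a h) * ((weight a : ℝ≥0∞) ^ t)⁻¹) := by
        refine Finset.sum_le_sum fun a ha => (wnorm_mul_le _ _ _).trans ?_
        calc _ ≤ wnorm t (q a h) * (2⁻¹ * ((weight a : ℝ≥0∞) ^ t)⁻¹) := by
              gcongr
              exact hGt a ha
          _ = _ := by ring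
      _ ≤ _ := by
        rw [← Finset.mul_sum]
        gcongr
        exact hqsum h
  have hTc : ∀ h c, MvPowerSeries.coeff c (T h) =
      -∑ a ∈ A, ∑ p ∈ Finset.HasAntidiagonal.antidiagonal c,
        MvPowerSeries.coeff p.1 (q a h) * MvPowerSeries.coeff p.2 (G a) := fun h c => by
    simp only [T, map_neg, map_sum, MvPowerSeries.coeff_mul]
  have hqs : ∀ (h : ℕ → MvPowerSeries (Fin n) ℂ) (H : MvPowerSeries (Fin n) ℂ),
      (∀ b, HasSum (fun k => MvPowerSeries.coeff b (h k)) (MvPowerSeries.coeff b H)) →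
      ∀ a c, HasSum (fun k => MvPowerSeries.coeff c (q a (h k)))
        (MvPowerSeries.coeff c (q a H)) := fun h H hHs a c => by
    simp only [hq]
    split_ifs
    · exact hHs _
    · exact hasSum_zero
  clear_value q
  obtain ⟨H, hHnorm, hH⟩ := exists_eq_add_apply hft T hT fun h H hHs c => by
    simp only [hTc]
    exact (hasSum_sum fun a _ => hasSum_sum fun p _ => (hqs h H hHs a p.1).mul_right _).neg
  refine ⟨fun a => q a H, fun a ha => isConvergentSeries_iff.mpr ⟨t, ?_⟩, ?_⟩
  · have h1 := (Finset.single_le_sum (f := fun a => wnorm t (q a H) * ((weight a : ℝ≥0∞) ^ t)⁻¹)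
      (fun _ _ => zero_le) ha).trans (hqsum H)
    intro h2
    simp only [h2] at h1
    rw [ENNReal.top_mul (ENNReal.inv_ne_zero.mpr (weight_pow_ne_top a t)), top_le_iff] at h1
    exact hHnorm h1
  · intro b hb
    have h1 : f - ∑ a ∈ A, q a H * g a = H - ∑ a ∈ A, q a H * MvPowerSeries.monomial a 1 := by
      have h2 : ∑ a ∈ A, q a H * g a =
          ∑ a ∈ A, q a H * G a + ∑ a ∈ A, q a H * MvPowerSeries.monomial a 1 := by
        rw [← Finset.sum_add_distrib]
        refine Finset.sum_congr rfl fun a _ => ?_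
        simp only [G]
        ring
      have h3 : f = H + ∑ a ∈ A, q a H * G a := by
        have h4 : H = f + -∑ a ∈ A, q a H * G a := hH
        linear_combination -h4
      rw [h2]
      linear_combination h3
    rw [h1, map_sub, map_sum, sub_eq_zero, Finset.sum_eq_single (sel b)]
    · rw [MvPowerSeries.coeff_mul_monomial, if_pos (hsel b hb).2, hq,
        tsub_add_cancel_of_le (hsel b hb).2, if_pos ⟨hb, rfl⟩, mul_one]
    · intro a _ hab
      rw [MvPowerSeries.coeff_mul_monomial]
      split_ifs with hle
      · rw [hq, tsub_add_cancel_of_le hle, if_neg fun h => hab h.2.symm, zero_mul]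
      · rfl
    · intro hb'
      exact absurd (hsel b hb).1 hb'

/-- **Dickson's lemma**. -/
lemma exists_finset_forall_exists_le (E : Set (Fin n →₀ ℕ)) :
    ∃ A : Finset (Fin n →₀ ℕ), (∀ a ∈ A, a ∈ E) ∧ ∀ b ∈ E, ∃ a ∈ A, a ≤ b := by
  have hfin : {a | Minimal (· ∈ E) a}.Finite :=
    WellQuasiOrderedLE.finite_of_isAntichain (setOfPred_minimal_antichain _)
  refine ⟨hfin.toFinset, fun a ha => ((hfin.mem_toFinset).mp ha).prop, fun b hb => ?_⟩
  obtain ⟨a, hab, ha⟩ := exists_minimal_le_of_wellFoundedLT (· ∈ E) b hb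
  exact ⟨a, hfin.mem_toFinset.mpr ha, hab⟩

/-- The ring of convergent power series is noetherian: the elements of an ideal whose leading
exponents generate the leading exponents of all of its elements generate the ideal. -/
instance isNoetherianRing (n : ℕ) : IsNoetherianRing (ConvergentSeries n) := by
  refine (isNoetherianRing_iff_ideal_fg _).mpr fun I => ?_
  let E : Set (Fin n →₀ ℕ) := {a | ∃ g ∈ I, MvPowerSeries.coeff a g.1 = 1 ∧
    ∀ b, b ≠ a → MvPowerSeries.coeff b g.1 ≠ 0 → weight a < weight b}
  classical
  have hE : ∀ f ∈ I, f ≠ 0 → ∃ a ∈ E, MvPowerSeries.coeff a f.1 ≠ 0 := by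
    intro f hf h0
    have h1 : ∃ a, MvPowerSeries.coeff a f.1 ≠ 0 := by
      by_contra! h
      exact h0 (Subtype.ext (MvPowerSeries.ext h))
    obtain ⟨a, ha, hmin⟩ := WellFounded.has_min (measure (weight (n := n))).wf
      {a | MvPowerSeries.coeff a f.1 ≠ 0} h1
    refine ⟨a, ⟨algebraMap ℂ _ (MvPowerSeries.coeff a f.1)⁻¹ * f, I.mul_mem_left _ hf, ?_, ?_⟩, ha⟩
    · rw [← Algebra.smul_def]
      exact inv_mul_cancel₀ ha
    · intro b hba hb
      rw [← Algebra.smul_def] at hb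
      have hb' : MvPowerSeries.coeff b f.1 ≠ 0 := fun h => hb (by
        change _ * MvPowerSeries.coeff b f.1 = 0
        rw [h, mul_zero])
      exact lt_of_le_of_ne (not_lt.mp (hmin b hb')) fun h => hba (weight_injective h).symm
  obtain ⟨A, hAE, hA⟩ := exists_finset_forall_exists_le E
  choose! g hgI hg1 hg2 using fun a (ha : a ∈ E) => ha
  refine ⟨A.image g, le_antisymm ?_ ?_⟩
  · rw [Submodule.span_le]
    intro x hx
    obtain ⟨a, ha, rfl⟩ := Finset.mem_image.mp (Finset.mem_coe.mp hx)
    exact hgI a (hAE a ha)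
  · intro f hf
    obtain ⟨q, hq, hrem⟩ := exists_division A (fun a => (g a).1) (fun a _ => (g a).2)
      (fun a ha => hg1 a (hAE a ha)) (fun a ha => hg2 a (hAE a ha)) f.2
    choose! Q hQ using fun a (ha : a ∈ A) => (⟨⟨q a, hq a ha⟩, rfl⟩ :
      ∃ Q : ConvergentSeries n, Q.1 = q a)
    have hmem : ∑ a ∈ A, Q a * g a ∈ Submodule.span (ConvergentSeries n) (A.image g : Set _) :=
      sum_mem fun a ha => Ideal.mul_mem_left _ _
        (Submodule.subset_span (Finset.mem_coe.mpr (Finset.mem_image_of_mem g ha)))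
    have hsub : f - ∑ a ∈ A, Q a * g a = 0 := by
      by_contra h0
      obtain ⟨b, hbE, hb⟩ := hE _ (I.sub_mem hf (sum_mem fun a ha =>
        I.mul_mem_left _ (hgI a (hAE a ha)))) h0
      apply hb
      rw [← hrem b (hA b hbE)]
      congr 1
      simp only [AddSubgroupClass.coe_sub, AddSubmonoidClass.coe_finsetSum, MulMemClass.coe_mul]
      rw [Finset.sum_congr rfl fun a ha => by rw [hQ a ha]]
    rw [sub_eq_zero.mp hsub]
    exact hmem

end ConvergentSeries

/-! ### Substitution into convergent power series -/

namespace ConvergentSeries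

open scoped ENNReal
open Filter Topology

variable {n : ℕ}

lemma subst_isConvergentSeries {f : MvPowerSeries (Fin n) ℂ} (hf : IsConvergentSeries f)
    (hf0 : MvPowerSeries.constantCoeff f = 0) {m : ℕ} {p : MvPowerSeries (Fin m) ℂ}
    (hp : IsConvergentSeries p) :
    IsConvergentSeries (MvPowerSeries.subst (fun _ : Fin m => f) p) := by
  have hs : MvPowerSeries.HasSubst fun _ : Fin m => f :=
    MvPowerSeries.hasSubst_of_constantCoeff_zero fun _ => hf0
  obtain ⟨t₁, ht₁⟩ := isConvergentSeries_iff.mp hp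
  obtain ⟨P, hP, hw⟩ := exists_weight_le m
  obtain ⟨t, ht⟩ := (eventually_wnorm_le hf (A := 1) (B := 2) one_pos one_lt_two (fun a ha => by
    have : a = 0 := (weight_eq_one_iff a).mp (by have := weight_pos a; omega)
    rw [this]
    exact hf0) (ε := ((P : ℝ≥0∞) ^ t₁)⁻¹)
      (ENNReal.inv_ne_zero.mpr (ENNReal.pow_ne_top (ENNReal.natCast_ne_top P)))).exists
  rw [Nat.cast_one, one_pow, inv_one, mul_one] at ht
  refine isConvergentSeries_iff.mpr ⟨t, ne_top_of_le_ne_top ht₁ ?_⟩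
  have hprod : ∀ d : Fin m →₀ ℕ, (d.prod fun _ k => f ^ k) = f ^ d.degree := fun d => by
    rw [Finsupp.prod, Finset.prod_pow_eq_pow_sum, Finsupp.degree_apply]
  calc wnorm t (MvPowerSeries.subst (fun _ : Fin m => f) p)
      ≤ ∑' e, (∑' d, ‖MvPowerSeries.coeff d p‖ₑ * ‖MvPowerSeries.coeff e (f ^ d.degree)‖ₑ) *
          ((weight e : ℝ≥0∞) ^ t)⁻¹ := by
        refine ENNReal.tsum_le_tsum fun e => ?_
        gcongr
        rw [MvPowerSeries.coeff_subst hs,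
          finsum_eq_sum_of_support_subset _
            (s := (MvPowerSeries.coeff_subst_finite hs p e).toFinset)
            (by simp)]
        refine (enorm_sum_le _ _).trans (le_trans (Finset.sum_le_sum fun d _ => ?_)
          (ENNReal.sum_le_tsum _))
        rw [hprod, smul_eq_mul, enorm_mul]
    _ = ∑' d, ‖MvPowerSeries.coeff d p‖ₑ * wnorm t (f ^ d.degree) := by
        simp_rw [← ENNReal.tsum_mul_right]
        rw [ENNReal.tsum_comm]
        unfold wnorm
        simp_rw [← ENNReal.tsum_mul_left, mul_assoc]
    _ ≤ wnorm t₁ p := by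
        refine ENNReal.tsum_le_tsum fun d => ?_
        gcongr
        calc wnorm t (f ^ d.degree) ≤ wnorm t f ^ d.degree := wnorm_pow_le _ _ _
          _ ≤ (((P : ℝ≥0∞) ^ t₁)⁻¹) ^ d.degree := by gcongr
          _ ≤ _ := by
            rw [← ENNReal.inv_pow, ← pow_mul, mul_comm, pow_mul, ENNReal.inv_le_inv]
            gcongr
            exact_mod_cast hw d

/-- The coordinate function of the line. -/
noncomputable def coord : ConvergentSeries 1 := ⟨MvPowerSeries.X 0, by
  refine ⟨1, one_pos, summable_of_ne_finset_zero (s := {Finsupp.single 0 1}) fun b hb => ?_⟩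
  rw [MvPowerSeries.X_def, MvPowerSeries.coeff_monomial_ne (by simpa using hb)]
  simp⟩

/-- For every convergent power series `f` without constant term there is an evaluation homomorphism
`p ↦ p(f)`. -/
lemma exists_algHom (f : ConvergentSeries n) (hf : MvPowerSeries.constantCoeff f.1 = 0) :
    ∃ φ : ConvergentSeries 1 →ₐ[ℂ] ConvergentSeries n, φ coord = f := by
  have hs : MvPowerSeries.HasSubst fun _ : Fin 1 => f.1 :=
    MvPowerSeries.hasSubst_of_constantCoeff_zero fun _ => hf
  refine ⟨((MvPowerSeries.substAlgHom (R := ℂ) hs).comp (ConvergentSeries 1).val).codRestrict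
    (ConvergentSeries n) fun p => ?_, Subtype.ext ?_⟩
  · change IsConvergentSeries _
    rw [AlgHom.comp_apply, MvPowerSeries.substAlgHom_apply]
    exact subst_isConvergentSeries f.2 hf p.2
  · exact MvPowerSeries.substAlgHom_X hs 0

lemma exists_eq_add_coord_mul (p : ConvergentSeries 1) :
    ∃ (c : ℂ) (q : ConvergentSeries 1), p = algebraMap ℂ _ c + coord * q := by
  let q : MvPowerSeries (Fin 1) ℂ := fun d => MvPowerSeries.coeff (d + Finsupp.single 0 1) p.1
  have hq : IsConvergentSeries q := by
    obtain ⟨r, hr, h⟩ := p.2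
    refine ⟨r, hr, ((h.comp_injective
      (add_left_injective (Finsupp.single (0 : Fin 1) 1))).mul_left r⁻¹).congr fun d => ?_⟩
    simp only [Function.comp_apply, map_add, Finsupp.degree_single, pow_add, pow_one]
    change _ = ‖MvPowerSeries.coeff (d + Finsupp.single 0 1) p.1‖ * r ^ d.degree
    field_simp
  refine ⟨MvPowerSeries.constantCoeff p.1, ⟨_, hq⟩, Subtype.ext (MvPowerSeries.ext fun d => ?_)⟩
  change MvPowerSeries.coeff d p.1 = MvPowerSeries.coeff d
    (MvPowerSeries.C (MvPowerSeries.constantCoeff p.1) + MvPowerSeries.X 0 * q)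
  classical
  rw [map_add, MvPowerSeries.X_def, MvPowerSeries.coeff_monomial_mul, MvPowerSeries.coeff_C,
    one_mul]
  by_cases hd : d = 0
  · subst hd
    simp
  · have h1 : Finsupp.single 0 1 ≤ d := by
      rw [Finsupp.single_le_iff]
      by_contra h0
      apply hd
      refine Finsupp.ext fun i => ?_
      rw [Subsingleton.elim i 0]
      simp only [Finsupp.coe_zero, Pi.zero_apply]
      omega
    rw [if_neg hd, if_pos h1, zero_add]
    change _ = MvPowerSeries.coeff (d - Finsupp.single 0 1 + Finsupp.single 0 1) p.1
    rw [tsub_add_cancel_of_le h1]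

lemma isUnit_of_constantCoeff_ne_zero (f : ConvergentSeries n)
    (hf : MvPowerSeries.constantCoeff f.1 ≠ 0) : IsUnit f :=
  IsUnit.of_mul_eq_one ⟨f.1⁻¹, IsConvergentSeries.inv f.2 hf⟩
    (Subtype.ext (MvPowerSeries.mul_inv_cancel f.1 hf))

end ConvergentSeries

/-! ### Local rings of germs and gluings -/

namespace AnalyticGerm

open IsLocalRing

instance (X : AnalyticGerm) : IsNoetherianRing X.O :=
  inferInstanceAs (IsNoetherianRing (ConvergentSeries X.n ⧸ X.ideal))

/-- The restriction of functions from the ambient space to a germ. -/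
noncomputable def proj (X : AnalyticGerm) : ConvergentSeries X.n →ₐ[ℂ] X.O :=
  Ideal.Quotient.mkₐ ℂ X.ideal

lemma proj_surjective (X : AnalyticGerm) : Function.Surjective X.proj :=
  Ideal.Quotient.mk_surjective

lemma exists_sub_mem (X : AnalyticGerm) (a : X.O) :
    ∃ c : ℂ, a - algebraMap ℂ X.O c ∈ maximalIdeal X.O := by
  obtain ⟨f, rfl⟩ := X.proj_surjective a
  refine ⟨MvPowerSeries.constantCoeff f.1, ?_⟩
  rw [← AlgHom.commutes X.proj, ← map_sub, mem_maximalIdeal, mem_nonunits_iff]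
  intro h
  have := Function.Surjective.isLocalHom (X.proj : ConvergentSeries X.n →+* X.O) X.proj_surjective
  have h1 : IsUnit (f - algebraMap ℂ _ (MvPowerSeries.constantCoeff f.1)) :=
    isUnit_of_map_unit (X.proj : ConvergentSeries X.n →+* X.O) _ h
  have h2 := (h1.map (ConvergentSeries X.n).val).map
    (MvPowerSeries.constantCoeff (σ := Fin X.n) (R := ℂ))
  have h3 : MvPowerSeries.constantCoeff ((ConvergentSeries X.n).val
      (f - algebraMap ℂ _ (MvPowerSeries.constantCoeff f.1))) = 0 := by
    rw [map_sub, map_sub, sub_eq_zero]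
    exact (MvPowerSeries.constantCoeff_C _).symm
  rw [h3] at h2
  exact not_isUnit_zero h2

/-- The germ of the complex line at the origin. -/
noncomputable def line : AnalyticGerm := ⟨1, ⊥, bot_ne_top⟩

/-- The identification of the local ring of the line with the ring of convergent power series in
one variable. -/
noncomputable def lineProj : ConvergentSeries 1 →ₐ[ℂ] line.O := line.proj

lemma lineProj_surjective : Function.Surjective lineProj := line.proj_surjective

/-- The coordinate function on the line. -/
noncomputable def lineCoord : line.O := lineProj ConvergentSeries.coord

/-- Every function that vanishes at the base point is a morphism to the line. -/
lemma exists_hom_line (X : AnalyticGerm) {a : X.O} (ha : a ∈ maximalIdeal X.O) :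
    ∃ φ : line.O →ₐ[ℂ] X.O, φ lineCoord = a := by
  obtain ⟨f, rfl⟩ := X.proj_surjective a
  have hf : MvPowerSeries.constantCoeff f.1 = 0 := by
    by_contra h
    exact ha ((ConvergentSeries.isUnit_of_constantCoeff_ne_zero f h).map X.proj)
  obtain ⟨φ, hφ⟩ := ConvergentSeries.exists_algHom f hf
  have h0 : ∀ x ∈ (⊥ : Ideal (ConvergentSeries 1)), X.proj (φ x) = 0 := fun x hx => by
    rw [(Ideal.mem_bot).mp hx, map_zero, map_zero]
  exact ⟨Ideal.Quotient.liftₐ (⊥ : Ideal (ConvergentSeries 1)) (X.proj.comp φ) h0,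
    congrArg X.proj hφ⟩

/-- Morphisms to the line are determined by the pull-back of the coordinate function: they agree
modulo all powers of the maximal ideal. -/
lemma hom_line_ext (X : AnalyticGerm) {φ ψ : line.O →ₐ[ℂ] X.O}
    (h : φ lineCoord = ψ lineCoord) (hφ : φ lineCoord ∈ maximalIdeal X.O) : φ = ψ := by
  have key : ∀ (k : ℕ) (p : ConvergentSeries 1),
      φ (lineProj p) - ψ (lineProj p) ∈ maximalIdeal X.O ^ k := by
    intro k
    induction k with
    | zero => simp
    | succ k ih =>
      intro p
      obtain ⟨c, q, rfl⟩ := ConvergentSeries.exists_eq_add_coord_mul p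
      have h1 : φ (lineProj (algebraMap ℂ _ c + ConvergentSeries.coord * q)) -
          ψ (lineProj (algebraMap ℂ _ c + ConvergentSeries.coord * q)) =
          φ lineCoord * (φ (lineProj q) - ψ (lineProj q)) := by
        simp only [map_add, map_mul, AlgHom.commutes]
        change _ + φ lineCoord * _ - (_ + ψ lineCoord * _) = _
        rw [← h]
        ring
      rw [h1, pow_succ']
      exact Ideal.mul_mem_mul hφ (ih q)
  refine AlgHom.ext fun x => ?_
  obtain ⟨p, rfl⟩ := lineProj_surjective x
  rw [← sub_eq_zero, ← Ideal.mem_bot, ← Ideal.iInf_pow_eq_bot_of_isLocalRing (maximalIdeal X.O)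
    (Ideal.IsPrime.ne_top inferInstance)]
  exact Ideal.mem_iInf.mpr fun k => key k p

section Gluing

variable {X Y Z V : AnalyticGerm} {α : Z ⟶ X} {β : Z ⟶ Y} {f : X ⟶ V} {g : Y ⟶ V}

lemma isLocalHom_pullback {f : X ⟶ Y} (hf : IsClosedEmbedding f) : IsLocalHom (pullback f) :=
  ⟨fun a ha => (Function.Surjective.isLocalHom (pullback f).toRingHom hf).map_nonunit a ha⟩

/-- The local ring of a gluing is contained in the product of the local rings of the pieces. -/
lemma eq_zero_of_isGluing (hV : IsGluing α β f g) (r : V.O) (hf : pullback f r = 0)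
    (hg : pullback g r = 0) : r = 0 := by
  have hr : r ∈ maximalIdeal V.O := by
    rw [mem_maximalIdeal, mem_nonunits_iff]
    intro h
    have h1 := h.map (pullback f)
    rw [hf] at h1
    exact not_isUnit_zero h1
  obtain ⟨φ, hφ⟩ := V.exists_hom_line hr
  obtain ⟨ψ, hψ⟩ := V.exists_hom_line (zero_mem _)
  have h1 : (show V ⟶ line from φ) = (show V ⟶ line from ψ) := by
    refine hV.hom_ext ?_ ?_
    · refine hom_line_ext X (φ := (pullback f).comp φ) (ψ := (pullback f).comp ψ) ?_ ?_
      · rw [AlgHom.comp_apply, AlgHom.comp_apply, hφ, hψ, hf, map_zero]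
      · rw [AlgHom.comp_apply, hφ, hf]
        exact zero_mem _
    · refine hom_line_ext Y (φ := (pullback g).comp φ) (ψ := (pullback g).comp ψ) ?_ ?_
      · rw [AlgHom.comp_apply, AlgHom.comp_apply, hφ, hψ, hg, map_zero]
      · rw [AlgHom.comp_apply, hφ, hg]
        exact zero_mem _
  rw [← hφ, ← hψ]
  exact congrArg (fun χ : V ⟶ line => pullback χ lineCoord) h1

/-- A pair of functions on the pieces which agree on the intersection is a function on the gluing:
if both vanish at the base point, it is a pair of morphisms to the line. -/
lemma exists_of_isGluing (hα : IsClosedEmbedding α) (hβ : IsClosedEmbedding β)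
    (hV : IsGluing α β f g) (a : X.O) (b : Y.O) (hab : pullback α a = pullback β b) :
    ∃ r : V.O, pullback f r = a ∧ pullback g r = b := by
  have := isLocalHom_pullback hα
  have := isLocalHom_pullback hβ
  obtain ⟨c, hc⟩ := X.exists_sub_mem a
  have hZ : pullback α (a - algebraMap ℂ _ c) = pullback β (b - algebraMap ℂ _ c) := by
    rw [map_sub, map_sub, hab, AlgHom.commutes, AlgHom.commutes]
  have hcZ : pullback α (a - algebraMap ℂ _ c) ∈ maximalIdeal Z.O := fun h =>
    hc (isUnit_of_map_unit (pullback α) _ h)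
  have hcY : b - algebraMap ℂ _ c ∈ maximalIdeal Y.O := by
    rw [mem_maximalIdeal, mem_nonunits_iff]
    intro h
    have h1 := h.map (pullback β)
    rw [← hZ] at h1
    exact hcZ h1
  obtain ⟨φ, hφ⟩ := X.exists_hom_line hc
  obtain ⟨ψ, hψ⟩ := Y.exists_hom_line hcY
  have hw : α ≫ (show X ⟶ line from φ) = β ≫ (show Y ⟶ line from ψ) := by
    refine hom_line_ext Z (φ := (pullback α).comp φ) (ψ := (pullback β).comp ψ) ?_ ?_
    · rw [AlgHom.comp_apply, AlgHom.comp_apply, hφ, hψ, hZ]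
    · rw [AlgHom.comp_apply, hφ]
      exact hcZ
  have h1 := congrArg (fun χ : X ⟶ line => pullback χ lineCoord) (hV.inl_desc _ _ hw)
  have h2 := congrArg (fun χ : Y ⟶ line => pullback χ lineCoord) (hV.inr_desc _ _ hw)
  refine ⟨pullback (hV.desc _ _ hw) lineCoord + algebraMap ℂ _ c, ?_, ?_⟩
  · rw [map_add, AlgHom.commutes]
    refine (congrArg (· + algebraMap ℂ X.O c) (h1.trans hφ)).trans (sub_add_cancel _ _)
  · rw [map_add, AlgHom.commutes]
    refine (congrArg (· + algebraMap ℂ Y.O c) (h2.trans hψ)).trans (sub_add_cancel _ _)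

end Gluing

end AnalyticGerm

namespace LocalTor

open IsLocalRing

universe u

/-! ### Betti numbers over a fibre product -/

/-- The first Betti numbers over the fibre product `R = A ×_C B` of modules over `B`, if the
Poincaré series of the residue field of `B` factors up to degree two, and that of `ker (A → C)` in
degree one. -/
theorem bet_fibreProduct {R A B C : Type u} [CommRing R] [CommRing A] [CommRing B] [CommRing C]
    [IsLocalRing R] [IsLocalRing A] [IsLocalRing B] [IsLocalRing C] [IsNoetherianRing R]
    [IsNoetherianRing A] [IsNoetherianRing B]
    [Algebra R A] [Algebra R B] [Algebra A C] [Algebra B C]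
    (hA : Function.Surjective (algebraMap R A)) (hB : Function.Surjective (algebraMap R B))
    (hAC : Function.Surjective (algebraMap A C)) (hBC : Function.Surjective (algebraMap B C))
    (hcomm : ∀ r, algebraMap A C (algebraMap R A r) = algebraMap B C (algebraMap R B r))
    (hinj : ∀ r, algebraMap R A r = 0 → algebraMap R B r = 0 → r = 0)
    (hex : ∀ a b, algebraMap A C a = algebraMap B C b →
      ∃ r, algebraMap R A r = a ∧ algebraMap R B r = b)
    (hk : ∀ j ≤ 2, bet R (ResidueField B) j =
      ∑ p ∈ Finset.HasAntidiagonal.antidiagonal j, bet B (ResidueField B) p.1 * bet R B p.2)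
    (hK : bet R (RingHom.ker (algebraMap A C)) 1 =
      ∑ p ∈ Finset.HasAntidiagonal.antidiagonal 1,
        bet A (RingHom.ker (algebraMap A C)) p.1 * bet R A p.2)
    (M : Type u) [AddCommGroup M] [Module R M] [Module B M] [IsScalarTower R B M]
    [Module.Finite B M] :
    bet R M 0 = bet B M 0 ∧
    bet R M 1 = bet B M 0 * bet A C 1 + bet B M 1 ∧
    bet R M 2 = bet B M 0 * bet B C 1 * bet A C 1 + bet B M 0 * bet A C 2 +
      bet B M 1 * bet A C 1 + bet B M 2 := by
  have eK : RingHom.ker (algebraMap R B) ≃ₗ[R] RingHom.ker (algebraMap A C) := by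
    refine LinearEquiv.ofBijective
      ((Algebra.linearMap R A).restrict (q := (RingHom.ker (algebraMap A C)).restrictScalars R)
        fun r hr => ?_) ⟨fun x y hxy => ?_, ?_⟩
    · change algebraMap A C (algebraMap R A r) = 0
      rw [hcomm, (RingHom.mem_ker).mp hr, map_zero]
    · have h1 : algebraMap R A x = algebraMap R A y := congrArg Subtype.val hxy
      refine Subtype.ext (sub_eq_zero.mp (hinj _ ?_ ?_))
      · rw [map_sub, h1, sub_self]
      · exact (RingHom.mem_ker).mp (sub_mem x.2 y.2)
    · rintro ⟨a, ha⟩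
      obtain ⟨r, hr, hr'⟩ := hex a 0 (by rw [map_zero]; exact ha)
      exact ⟨⟨r, hr'⟩, Subtype.ext hr⟩
  have eL : RingHom.ker (algebraMap R A) ≃ₗ[R] RingHom.ker (algebraMap B C) := by
    refine LinearEquiv.ofBijective
      ((Algebra.linearMap R B).restrict (q := (RingHom.ker (algebraMap B C)).restrictScalars R)
        fun r hr => ?_) ⟨fun x y hxy => ?_, ?_⟩
    · change algebraMap B C (algebraMap R B r) = 0
      rw [← hcomm, (RingHom.mem_ker).mp hr, map_zero]
    · have h1 : algebraMap R B x = algebraMap R B y := congrArg Subtype.val hxy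
      refine Subtype.ext (sub_eq_zero.mp (hinj _ ?_ ?_))
      · exact (RingHom.mem_ker).mp (sub_mem x.2 y.2)
      · rw [map_sub, h1, sub_self]
    · rintro ⟨b, hb⟩
      obtain ⟨r, hr, hr'⟩ := hex 0 b (by rw [map_zero]; exact hb.symm)
      exact ⟨⟨r, hr⟩, Subtype.ext hr'⟩
  have hB0 : bet R B 0 = 1 := by
    rw [bet_zero, mu_eq_of_surjective hB, ← bet_zero, bet_self, if_pos rfl]
  have hA0 : bet R A 0 = 1 := by
    rw [bet_zero, mu_eq_of_surjective hA, ← bet_zero, bet_self, if_pos rfl]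
  have hA1 : bet R A 1 = bet B C 1 := by
    rw [bet_succ_of_surjective hA, bet_congr eL, bet_succ_of_surjective hBC, bet_zero, bet_zero,
      mu_eq_of_surjective hB]
  have hB1 : bet R B 1 = bet A C 1 := by
    rw [bet_succ_of_surjective hB, bet_congr eK, bet_succ_of_surjective hAC, bet_zero, bet_zero,
      mu_eq_of_surjective hA]
  have hB2 : bet R B 2 = bet A C 1 * bet B C 1 + bet A C 2 := by
    rw [bet_succ_of_surjective hB, bet_congr eK, hK, Finset.Nat.sum_antidiagonal_succ,
      Finset.Nat.antidiagonal_zero, Finset.sum_singleton, hA0, hA1, mul_one,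
      bet_succ_of_surjective hAC, bet_succ_of_surjective hAC]
  have h := fun j hj => bet_eq_sum hB hk j hj M
  refine ⟨?_, ?_, ?_⟩
  · rw [h 0 (by omega), Finset.Nat.antidiagonal_zero, Finset.sum_singleton, hB0, mul_one]
  · rw [h 1 (by omega), Finset.Nat.sum_antidiagonal_succ, Finset.Nat.antidiagonal_zero,
      Finset.sum_singleton, hB0, hB1, mul_one]
  · rw [h 2 (by omega), Finset.Nat.sum_antidiagonal_succ, Finset.Nat.sum_antidiagonal_succ,
      Finset.Nat.antidiagonal_zero, Finset.sum_singleton, hB0, hB1, hB2, mul_one]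
    ring

/-- Over a local `ℂ`-algebra with residue field `ℂ`, a module of finite length has the same length
as a complex vector space: this holds for the simple modules. -/
lemma length_complex_eq {R : Type*} [CommRing R] [IsLocalRing R] [Algebra ℂ R]
    (hR : ∀ a : R, ∃ c : ℂ, a - algebraMap ℂ R c ∈ maximalIdeal R) (T : Type*) [AddCommGroup T]
    [Module R T] [Module ℂ T] [IsScalarTower ℂ R T] (hT : IsFiniteLength R T) :
    Module.length ℂ T = Module.length R T := by
  rename_i i1 i2 i3 i4
  revert i3 i4
  induction hT with
  | of_subsingleton =>
    intro _ _
    rw [Module.length_eq_zero, Module.length_eq_zero]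
  | @of_simple_quotient M _ _ N hs _ ih =>
    intro _ _
    obtain ⟨I, hI, ⟨e⟩⟩ := isSimpleModule_iff_quot_maximal.mp hs
    have hIm : I = maximalIdeal R := eq_maximalIdeal hI
    have h1 := Module.length_eq_add_of_exact N.subtype N.mkQ N.subtype_injective N.mkQ_surjective
      (LinearMap.exact_subtype_mkQ N)
    have h2 := Module.length_eq_add_of_exact (N.subtype.restrictScalars ℂ)
      (N.mkQ.restrictScalars ℂ) N.subtype_injective N.mkQ_surjective
      (LinearMap.exact_subtype_mkQ N)
    have h3 : Function.Surjective (algebraMap ℂ (R ⧸ I)) := by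
      intro x
      obtain ⟨a, rfl⟩ := Ideal.Quotient.mk_surjective x
      obtain ⟨c, hc⟩ := hR a
      exact ⟨c, ((Ideal.Quotient.eq).mpr (hIm ▸ hc)).symm⟩
    have h4 : Module.length ℂ (M ⧸ N) = Module.length R (M ⧸ N) := by
      rw [e.length_eq, (e.restrictScalars ℂ).length_eq,
        Module.length_eq_of_surjective (S := R) (R := R ⧸ I) Ideal.Quotient.mk_surjective,
        Module.length_eq_of_surjective h3]
    rw [h1, h2, ih, h4]

end LocalTor

namespace AnalyticGerm

open IsLocalRing LocalTor

/-! ### Betti numbers of germs -/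

/-- The algebra structure on the local ring of the source of a morphism of germs. -/
noncomputable abbrev algebraOfHom {X Y : AnalyticGerm} (f : Y ⟶ X) : Algebra X.O Y.O :=
  (pullback f).toRingHom.toAlgebra

/-- The complex dimensions of `Tor` are its lengths, as the residue field of `X` is `ℂ`. -/
lemma moduleBetti_eq (X : AnalyticGerm) (M : Type) [AddCommGroup M] [Module X.O M]
    [Module.Finite X.O M] (i : ℕ) : (moduleBetti X (ModuleCat.of X.O M) i : ℕ∞) = bet X.O M i := by
  let T := tor X.O i M
  let _ : Module ℂ T := Module.restrictScalars ℂ X.O T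
  have : IsScalarTower ℂ X.O T := ⟨fun c x t => by
    rw [Algebra.smul_def, mul_smul]
    rfl⟩
  have hT : Module.length X.O T ≠ ⊤ := bet_ne_top i
  have key := length_complex_eq X.exists_sub_mem T (Module.length_ne_top_iff.mp hT)
  have := (isFiniteLength_iff_isNoetherian_isArtinian.mp
    (Module.length_ne_top_iff.mp (key.trans_ne hT))).1
  have h := key
  rw [Module.length_eq_finrank] at h
  exact h

lemma moduleBetti_restrict {X Y : AnalyticGerm} {f : Y ⟶ X} (hf : IsClosedEmbedding f) (M : Type)
    [AddCommGroup M] [Module Y.O M] [Module.Finite Y.O M] (i : ℕ) :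
    letI := algebraOfHom f
    letI : Module X.O M := Module.restrictScalars X.O Y.O M
    (moduleBetti X (restrict f (ModuleCat.of Y.O M)) i : ℕ∞) = bet X.O M i := by
  let := algebraOfHom f
  let _ : Module X.O M := Module.restrictScalars X.O Y.O M
  have : IsScalarTower X.O Y.O M := ⟨fun c x t => by
    rw [Algebra.smul_def, mul_smul]
    rfl⟩
  have : Module.Finite X.O Y.O := Module.Finite.of_surjective (Algebra.linearMap X.O Y.O) hf
  have : Module.Finite X.O M := Module.Finite.trans Y.O M
  exact moduleBetti_eq X M i

lemma betti_eq {X Y : AnalyticGerm} {f : Y ⟶ X} (hf : IsClosedEmbedding f) (i : ℕ) :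
    letI := algebraOfHom f
    (betti f i : ℕ∞) = bet X.O Y.O i := by
  let := algebraOfHom f
  let m : Module X.O Y.O := Module.restrictScalars X.O Y.O Y.O
  refine (moduleBetti_restrict hf Y.O i).trans ?_
  exact bet_congr (M := Y.O) (N := Y.O) { AddEquiv.refl Y.O with map_smul' := fun _ _ => rfl } i

lemma coeff_poincare {X Y : AnalyticGerm} (f : Y ⟶ X) (i : ℕ) :
    PowerSeries.coeff i (poincare f) = betti f i := PowerSeries.coeff_mk _ _

lemma coeff_modulePoincare (X : AnalyticGerm) (M : ModuleCat.{0} X.O) (i : ℕ) :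
    PowerSeries.coeff i (modulePoincare X M) = moduleBetti X M i := PowerSeries.coeff_mk _ _

/-- The reduced point of a germ. -/
noncomputable def point (X : AnalyticGerm) : AnalyticGerm :=
  ⟨X.n, maximalIdeal (ConvergentSeries X.n), Ideal.IsPrime.ne_top inferInstance⟩

/-- The inclusion of the reduced point. -/
noncomputable def pointHom (X : AnalyticGerm) : X.point ⟶ X :=
  show (ConvergentSeries X.n ⧸ X.ideal) →ₐ[ℂ]
      ConvergentSeries X.n ⧸ maximalIdeal (ConvergentSeries X.n) from
    Ideal.Quotient.factorₐ ℂ (le_maximalIdeal X.ideal_ne_top)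

lemma isClosedEmbedding_pointHom (X : AnalyticGerm) : IsClosedEmbedding X.pointHom :=
  show Function.Surjective (Ideal.Quotient.factor (le_maximalIdeal X.ideal_ne_top)) from
    Ideal.Quotient.factor_surjective _

lemma isField_point (X : AnalyticGerm) : IsField X.point.O :=
  (Ideal.Quotient.maximal_ideal_iff_isField_quotient _).mp
    (inferInstanceAs (maximalIdeal (ConvergentSeries X.n)).IsMaximal)

/-- The local ring of the reduced point is the residue field. -/
noncomputable def pointEquiv (X : AnalyticGerm) :
    letI := algebraOfHom X.pointHom
    X.point.O ≃ₐ[X.O] ResidueField X.O :=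
  letI := algebraOfHom X.pointHom
  have h : RingHom.ker (Algebra.ofId X.O X.point.O) = maximalIdeal X.O := by
    let := X.isField_point.toField
    exact eq_maximalIdeal (RingHom.ker_isMaximal_of_surjective
      (Algebra.ofId X.O X.point.O) X.isClosedEmbedding_pointHom)
  (Ideal.quotientKerAlgEquivOfSurjective (f := Algebra.ofId X.O X.point.O)
    X.isClosedEmbedding_pointHom).symm.trans (Ideal.quotientEquivAlgOfEq X.O h)

lemma isClosedEmbedding_comp {X Y Z : AnalyticGerm} {f : X ⟶ Y} {g : Y ⟶ Z}
    (hf : IsClosedEmbedding f) (hg : IsClosedEmbedding g) : IsClosedEmbedding (f ≫ g) :=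
  Function.Surjective.comp (g := pullback f) hf hg

/-- Largeness, tested on the reduced point. -/
lemma bet_residueField_of_isLarge {X Y : AnalyticGerm} {f : Y ⟶ X} (hf : IsClosedEmbedding f)
    (h : IsLarge f) (j : ℕ) :
    letI := algebraOfHom f
    bet X.O (ResidueField Y.O) j = ∑ p ∈ Finset.HasAntidiagonal.antidiagonal j,
      bet Y.O (ResidueField Y.O) p.1 * bet X.O Y.O p.2 := by
  let := algebraOfHom f
  let := algebraOfHom Y.pointHom
  let := algebraOfHom (Y.pointHom ≫ f)
  have : IsScalarTower X.O Y.O Y.point.O := IsScalarTower.of_algebraMap_eq fun _ => rfl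
  have hp := Y.isClosedEmbedding_pointHom
  have hred : IsReduced Y.point.O := by
    let := Y.isField_point.toField
    have : IsDomain Y.point.O := Y.isField_point.isDomain
    infer_instance
  have h1 := congrArg (PowerSeries.coeff j) (h Y.point Y.pointHom hred hp)
  rw [PowerSeries.coeff_mul] at h1
  simp only [coeff_poincare] at h1
  have h2 := congrArg (Nat.cast (R := ℕ∞)) h1
  rw [Nat.cast_sum, betti_eq (isClosedEmbedding_comp hp hf)] at h2
  simp only [Nat.cast_mul, betti_eq hp, betti_eq hf] at h2
  simp only [← bet_congr Y.pointEquiv.toLinearEquiv]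
  rw [← bet_congr (Y.pointEquiv.toLinearEquiv.restrictScalars X.O)]
  exact h2

end AnalyticGerm

open AnalyticGerm LocalTor in
theorem corollary3p14 {X Y Z V W : AnalyticGerm}
    (α : Z ⟶ X) (β : Z ⟶ Y)
    (hα : AnalyticGerm.IsClosedEmbedding α) (hβ : AnalyticGerm.IsClosedEmbedding β)
    (f : X ⟶ V) (g : Y ⟶ V) (hV : AnalyticGerm.IsGluing α β f g)
    (h : (AnalyticGerm.IsWeaklyLarge α f ∧
            ∃ γ : X ⟶ Y, AnalyticGerm.IsClosedEmbedding γ ∧ α ≫ γ = β) ∨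
          AnalyticGerm.IsStronglyLarge f g)
    (w : W ⟶ Y) (hw : AnalyticGerm.IsClosedEmbedding w) :
    AnalyticGerm.betti (w ≫ g) 0 = AnalyticGerm.betti w 0 ∧
    AnalyticGerm.betti (w ≫ g) 1 =
      AnalyticGerm.betti w 0 * AnalyticGerm.betti α 1 + AnalyticGerm.betti w 1 ∧
    AnalyticGerm.betti (w ≫ g) 2 =
      AnalyticGerm.betti w 0 * AnalyticGerm.betti β 1 * AnalyticGerm.betti α 1 +
        AnalyticGerm.betti w 0 * AnalyticGerm.betti α 2 +
        AnalyticGerm.betti w 1 * AnalyticGerm.betti α 1 + AnalyticGerm.betti w 2 := by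
  have hf : IsClosedEmbedding f := fun a => by
    obtain ⟨b, hb⟩ := hβ (pullback α a)
    obtain ⟨r, hr, -⟩ := exists_of_isGluing hα hβ hV a b hb.symm
    exact ⟨r, hr⟩
  have hg : IsClosedEmbedding g := fun b => by
    obtain ⟨a, ha⟩ := hα (pullback β b)
    obtain ⟨r, -, hr⟩ := exists_of_isGluing hα hβ hV a b ha
    exact ⟨r, hr⟩
  let := algebraOfHom f
  let := algebraOfHom g
  let := algebraOfHom α
  let := algebraOfHom β
  let := algebraOfHom w
  let := algebraOfHom (w ≫ g)
  have : IsScalarTower V.O Y.O W.O := IsScalarTower.of_algebraMap_eq fun _ => rfl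
  have : Module.Finite Y.O W.O := Module.Finite.of_surjective (Algebra.linearMap Y.O W.O) hw
  have hcomm : ∀ r, pullback α (pullback f r) = pullback β (pullback g r) := fun r =>
    congrArg (fun φ => pullback φ r) hV.w
  have hk : ∀ j ≤ 2, bet V.O (IsLocalRing.ResidueField Y.O) j =
      ∑ p ∈ Finset.HasAntidiagonal.antidiagonal j,
        bet Y.O (IsLocalRing.ResidueField Y.O) p.1 * bet V.O Y.O p.2 := by
    rcases h with ⟨-, γ, -, hγ⟩ | ⟨-, hlarge⟩
    · have hαγ : ∀ b, pullback α (pullback γ b) = pullback β b := fun b =>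
        congrArg (fun φ => pullback φ b) hγ
      -- The retraction of `V` to `Y` is `γ` on `X` and the identity on `Y`.
      have hρ : α ≫ γ = β ≫ 𝟙 Y := hγ.trans (Category.comp_id β).symm
      exact bet_residueField_of_retract (pullback (hV.desc γ (𝟙 Y) hρ)).toRingHom fun b =>
        congrArg (fun φ => pullback φ b) (hV.inr_desc γ (𝟙 Y) hρ)
    · exact fun j _ => bet_residueField_of_isLarge hg hlarge j
  have hK : bet V.O (RingHom.ker (algebraMap X.O Z.O)) 1 =
      ∑ p ∈ Finset.HasAntidiagonal.antidiagonal 1,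
        bet X.O (RingHom.ker (algebraMap X.O Z.O)) p.1 * bet V.O X.O p.2 := by
    rcases h with ⟨hweak, -⟩ | ⟨hlarge, -⟩
    · have h1 := congrArg (PowerSeries.coeff 1) hweak
      rw [PowerSeries.coeff_mul] at h1
      simp only [coeff_poincare, coeff_modulePoincare] at h1
      have h2 := congrArg (Nat.cast (R := ℕ∞)) h1
      rw [Nat.cast_sum, kernelModule, moduleBetti_restrict hf] at h2
      simp only [Nat.cast_mul, betti_eq hf, moduleBetti_eq] at h2
      exact h2
    · exact bet_eq_sum hf (fun j _ => bet_residueField_of_isLarge hf hlarge j) 1 le_rfl _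
  have key := bet_fibreProduct (R := V.O) (A := X.O) (B := Y.O) (C := Z.O) hf hg hα hβ hcomm
    (eq_zero_of_isGluing hV) (exists_of_isGluing hα hβ hV) hk hK W.O
  have hwg := isClosedEmbedding_comp hw hg
  rw [← betti_eq hwg, ← betti_eq hwg, ← betti_eq hwg, ← betti_eq hw, ← betti_eq hw,
    ← betti_eq hw, ← betti_eq hα, ← betti_eq hα, ← betti_eq hβ] at key
  exact_mod_cast key
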